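/- Let $\Bbbk$ be an algebraically closed field of characteristic zero, let $r,w\geq 1$, and let $\mathbb{G}_a^r\rtimes_w\mathbb{G}_m$ be the semi-direct product in which $t\in\mathbb{G}_m$ acts on $\mathbb{G}_a^r$ by $u\mapsto t^wu$. Put $\mathfrak{u}=\mathrm{Lie}(\mathbb{G}_a^r)$. A variety is an integral scheme, separated and of finite type over $\Bbbk$; points are $\Bbbk$-rational points. An affine cone with an action of $\mathbb{G}_a^r\rtimes_w\mathbb{G}_m$ is an affine morphism of varieties $\pi:C\to S$, together with an action of $\mathbb{G}_a^r\rtimes_w\mathbb{G}_m$ on $C$ for which $\pi$ is invariant, such that the $\mathbb{G}_m$-weights give a grading $\mathcal{A}:=\pi_*\mathcal{O}_C=\bigoplus_{n\geq0}\mathcal{A}_n$ with $\mathcal{A}_0=\mathcal{O}_S$ (where $f\in\mathcal{A}_n$ means $f(t.x)=t^nf(x)$). Its zero section is $Z:=\mathbb{V}(\mathcal{A}_{>0})\subseteq C$. For $x\in C$ let $\mathrm{Stab}_{\mathfrak{u}}(x)\subseteq\mathfrak{u}$ be the Lie algebra stabiliser, and put $d(\pi):=\min_{z\in Z}\dim\mathrm{Stab}_{\mathfrak{u}}(z)$.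 Let $\mathcal{Q}(\pi)$ be the cokernel of $\Omega_{\mathcal{A}/\mathcal{A}_0}\to\mathfrak{u}^*\otimes\mathcal{A}$, $\mathrm{d}f\mapsto\sum_iu_i\otimes\xi_i.f$, where $\xi_1,\dots,\xi_r$ and $u_1,\dots,u_r$ are dual bases of $\mathfrak{u}$ and $\mathfrak{u}^*$, and $\xi_i.f$ is the derivative of $f$ along the vector field of $\xi_i$. Let $Z^{\mathrm{reg}}:=\{z\in Z:\dim\mathrm{Stab}_{\mathfrak{u}}(z)=d(\pi)\}$. Give $Z\setminus Z^{\mathrm{reg}}$ the closed subscheme structure with ideal $\mathcal{I}:=\mathrm{Fit}_{d(\pi)}(\mathcal{Q}(\pi))+\mathcal{A}_{>0}$, and let $\overline{\mathbb{G}_a^r.(Z\setminus Z^{\mathrm{reg}})}\subseteq C$ be the scheme theoretic image of the action morphism $\mathbb{G}_a^r\times(Z\setminus Z^{\mathrm{reg}})\to C$, that is, the closed subscheme with ideal $\mathcal{J}:=\ker\big(\mathcal{A}\to\mathcal{O}(\mathbb{G}_a^r)\otimes\mathcal{A}/\mathcal{I}\big)$. The modification of $\pi:C\to S$ with centre a $\mathbb{G}_a^r\rtimes_w\mathbb{G}_m$-invariant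 closed subscheme $V$ is the affine cone $\pi':C'\to S'$ with an action of $\mathbb{G}_a^r\rtimes_w\mathbb{G}_m$, in a commutative square with $p:C'\to C$ and $q:S'\to S$, such that $C'\subseteq\mathrm{Bl}_V(C)$ is the open stratum of the Białynicki-Birula stratification of $\mathrm{Bl}_V(C)$ (the strata being the sets of points $x$ with $\lim_{t\to0}t.x$ in a given connected component of the fixed locus of $\mathbb{G}_m$), $p$ is the restriction of the blowing up, and the actions on $C'$ are those for which $p$ is equivariant. Let $\pi:C\to S$ be an affine cone with an action of $\mathbb{G}_a^r\rtimes_w\mathbb{G}_m$, and let $\pi':C'\to S'$ be its modification with centre $\overline{\mathbb{G}_a^r.(Z\setminus Z^{\mathrm{reg}})}$, with zero section $Z'\subseteq C'$. Then $\dim\mathrm{Stab}_{\mathfrak{u}}(z')=d(\pi)$ for every $z'\in Z'$. In particular $d(\pi')=d(\pi)$. -/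

import Mathlib

open CategoryTheory AlgebraicGeometry TopologicalSpace

universe u

noncomputable section

namespace AdditiveCone

/-! ### Schemes over a field and their points -/

/-- Schemes over `k`. -/
abbrev SchOver (k : Type u) [Field k] := Over (Spec (CommRingCat.of k))

section Points

variable (k : Type u) [Field k]

/-- The final `k`-scheme `Spec k`. -/
abbrev pt : SchOver k := Over.mk (𝟙 (Spec (CommRingCat.of k)))

variable {k}

/-- The structure morphism `T ⟶ Spec k`. -/
abbrev toPt (T : SchOver k) : T ⟶ pt k := Over.homMk T.hom

/-- The `k`-rational points of `X`. -/
abbrev KPoint (X : SchOver k) := pt k ⟶ X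

/-- The topological point underlying a `k`-rational point. -/
def KPoint.pos {X : SchOver k} (x : KPoint X) : X.left :=
  x.left (IsLocalRing.closedPoint k)

variable (k) in
/-- The spectrum of a `k`-algebra, as a `k`-scheme. -/
abbrev specOver (R : Type u) [CommRing R] [Algebra k R] : SchOver k :=
  Over.mk (Spec.map (CommRingCat.ofHom (algebraMap k R)))

/-- The morphism of spectra given by a homomorphism of `k`-algebras. -/
abbrev specOverMap {R R' : Type u} [CommRing R] [CommRing R'] [Algebra k R] [Algebra k R']
    (φ : R →ₐ[k] R') : specOver k R' ⟶ specOver k R :=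
  Over.homMk (Spec.map (CommRingCat.ofHom φ.toRingHom)) (by
    simp only [Over.mk_hom, ← Spec.map_comp, ← CommRingCat.ofHom_comp]
    congr 2
    exact φ.comp_algebraMap)

/-- The `k`-rational point of `Spec R` given by a homomorphism of `k`-algebras `R → k`. -/
abbrev specPoint {R : Type u} [CommRing R] [Algebra k R] (φ : R →ₐ[k] k) :
    KPoint (specOver k R) :=
  Over.homMk (Spec.map (CommRingCat.ofHom φ.toRingHom)) (by
    simp only [Over.mk_hom, ← Spec.map_comp, ← CommRingCat.ofHom_comp]
    rw [show φ.toRingHom.comp (algebraMap k R) = RingHom.id k from φ.comp_algebraMap]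
    exact Spec.map_id _)

/-- An element of `R` as a global function on `Spec R`. -/
abbrev specFun {R : CommRingCat.{u}} : R →+* Γ(Spec R, ⊤) := (Scheme.ΓSpecIso R).inv.hom

end Points

/-! ### Actions of `𝔾ₐ^r` and `𝔾ₘ`, through functors of points -/

section Actions

variable {k : Type u} [Field k]

/-- An action of `𝔾ₐ^r` on the `k`-scheme `X`: the groups `𝔾ₐ^r(T) = Γ(T, 𝒪_T)^r` act on the sets
`X(T)`, naturally in the `k`-scheme `T`. -/
structure GaAction (r : ℕ) (X : SchOver k) where
  act : ∀ {T : SchOver k}, (Fin r → Γ(T.left, ⊤)) → (T ⟶ X) → (T ⟶ X)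
  act_zero : ∀ {T : SchOver k} (x : T ⟶ X), act 0 x = x
  act_add : ∀ {T : SchOver k} (u v : Fin r → Γ(T.left, ⊤)) (x : T ⟶ X),
    act (u + v) x = act u (act v x)
  naturality : ∀ {T T' : SchOver k} (f : T' ⟶ T) (u : Fin r → Γ(T.left, ⊤)) (x : T ⟶ X),
    f ≫ act u x = act (fun i ↦ f.left.appTop.hom (u i)) (f ≫ x)

/-- An action of `𝔾ₘ` on the `k`-scheme `X`: the groups `𝔾ₘ(T) = Γ(T, 𝒪_T)ˣ` act on the sets
`X(T)`, naturally in the `k`-scheme `T`. -/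
structure GmAction (X : SchOver k) where
  act : ∀ {T : SchOver k}, (Γ(T.left, ⊤))ˣ → (T ⟶ X) → (T ⟶ X)
  act_one : ∀ {T : SchOver k} (x : T ⟶ X), act 1 x = x
  act_mul : ∀ {T : SchOver k} (s t : (Γ(T.left, ⊤))ˣ) (x : T ⟶ X),
    act (s * t) x = act s (act t x)
  naturality : ∀ {T T' : SchOver k} (f : T' ⟶ T) (t : (Γ(T.left, ⊤))ˣ) (x : T ⟶ X),
    f ≫ act t x = act (Units.map f.left.appTop.hom.toMonoidHom t) (f ≫ x)

/-- The actions of `𝔾ₐ^r` and `𝔾ₘ` constitute an action of `𝔾ₐ^r ⋊_w 𝔾ₘ`, where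
`t u t⁻¹ = t ^ w u`. -/
def IsSemidirect {r : ℕ} (w : ℕ) {X : SchOver k} (ga : GaAction r X) (gm : GmAction X) : Prop :=
  ∀ {T : SchOver k} (t : (Γ(T.left, ⊤))ˣ) (u : Fin r → Γ(T.left, ⊤)) (x : T ⟶ X),
    gm.act t (ga.act u x) = ga.act (fun i ↦ (t : Γ(T.left, ⊤)) ^ w * u i) (gm.act t x)

/-- The functions `f` of weight `n` on the open subset `V`: those with `f(t.x) = t ^ n f(x)`. -/
def GmAction.weight {X : SchOver k} (gm : GmAction X) (V : X.left.Opens) (n : ℕ) :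
    AddSubgroup Γ(X.left, V) where
  carrier := {f | ∀ (T : SchOver k) (t : (Γ(T.left, ⊤))ˣ) (x : T ⟶ X)
    (h : ⊤ ≤ x.left ⁻¹ᵁ V) (h' : ⊤ ≤ (gm.act t x).left ⁻¹ᵁ V),
    ((gm.act t x).left.appLE V ⊤ h').hom f =
      (t : Γ(T.left, ⊤)) ^ n * (x.left.appLE V ⊤ h).hom f}
  zero_mem' := by intro T t x h h'; simp
  add_mem' := by
    intro f g hf hg T t x h h'
    rw [map_add, map_add, hf T t x h h', hg T t x h h', mul_add]
  neg_mem' := by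
    intro f hf T t x h h'
    rw [map_neg, map_neg, hf T t x h h', mul_neg]

/-- The Lie algebra stabiliser `Stab_𝔲(x) ⊆ 𝔲 = Lie(𝔾ₐ^r) = k^r` of a `k`-rational point `x`: the
`ξ` such that `ε ξ ∈ 𝔾ₐ^r(k[ε])` fixes `x`, viewed as a `k[ε]`-point. -/
def GaAction.lieStab {r : ℕ} {X : SchOver k} (ga : GaAction r X) (x : KPoint X) :
    Submodule k (Fin r → k) where
  carrier := {ξ | ga.act (T := specOver k (DualNumber k))
    (fun i ↦ specFun (R := .of (DualNumber k)) (TrivSqZeroExt.inr (ξ i))) (toPt _ ≫ x) =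
      toPt _ ≫ x}
  zero_mem' := by
    have := ga.act_zero (T := specOver k (DualNumber k)) (toPt _ ≫ x)
    simp only [Set.mem_ofPred_eq, Pi.zero_apply, TrivSqZeroExt.inr_zero, map_zero]
    exact this
  add_mem' := by
    intro ξ η hξ hη
    simp only [Set.mem_ofPred_eq, Pi.add_apply, TrivSqZeroExt.inr_add, map_add] at hξ hη ⊢
    refine (ga.act_add (T := specOver k (DualNumber k)) _ _ _).trans ?_
    rw [hη, hξ]
  smul_mem' := by
    intro c ξ hξ
    simp only [Set.mem_ofPred_eq] at hξ ⊢
    let φ : DualNumber k →ₐ[k] DualNumber k := TrivSqZeroExt.map (c • LinearMap.id)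
    have h1 : specOverMap φ ≫ toPt (specOver k (DualNumber k)) = toPt _ := by
      ext1
      simpa using Over.w (specOverMap φ)
    have h2 := ga.naturality (specOverMap φ)
      (fun i ↦ specFun (R := .of (DualNumber k)) (TrivSqZeroExt.inr (ξ i))) (toPt _ ≫ x)
    rw [hξ, ← Category.assoc, h1] at h2
    refine Eq.trans ?_ h2.symm
    congr 1
    funext i
    have h3 := Scheme.ΓSpecIso_inv_naturality (CommRingCat.ofHom φ.toRingHom)
    have h4 := congr($(h3).hom (TrivSqZeroExt.inr (ξ i)))
    simp only [CommRingCat.hom_comp, RingHom.comp_apply] at h4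
    refine Eq.trans ?_ h4
    congr 1
    exact (TrivSqZeroExt.map_inr (R' := k) (c • (LinearMap.id : k →ₗ[k] k)) (ξ i)).symm

/-! ### Limits and the Białynicki-Birula stratification -/

/-- The coordinate function `t` on `𝔾ₘ = Spec k[t, t⁻¹]`, as a point of `𝔾ₘ` with values in
`𝔾ₘ`. -/
def unitT (k : Type u) [Field k] : (Γ((specOver k (LaurentPolynomial k)).left, ⊤))ˣ :=
  Units.map (specFun (R := .of (LaurentPolynomial k))).toMonoidHom
    ⟨LaurentPolynomial.T 1, LaurentPolynomial.T (-1),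
      by rw [← LaurentPolynomial.T_add]; simp, by rw [← LaurentPolynomial.T_add]; simp⟩

/-- `lim_{t → 0} t.x = y`: the orbit map `𝔾ₘ → X`, `t ↦ t.x`, extends to a morphism `𝔸¹ → X` with
value `y` at `0`. -/
def GmAction.HasLimit {X : SchOver k} (gm : GmAction X) (x y : KPoint X) : Prop :=
  ∃ l : specOver k (Polynomial k) ⟶ X,
    specOverMap Polynomial.toLaurentAlg ≫ l = gm.act (unitT k) (toPt _ ≫ x) ∧
    specPoint (Polynomial.aeval (0 : k)) ≫ l = y

/-- A `k`-rational point fixed by `𝔾ₘ`. -/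
def GmAction.IsFixed {X : SchOver k} (gm : GmAction X) (x : KPoint X) : Prop :=
  ∀ (T : SchOver k) (t : (Γ(T.left, ⊤))ˣ), gm.act t (toPt T ≫ x) = toPt T ≫ x

/-- The set of the `k`-rational points fixed by `𝔾ₘ`. -/
def GmAction.fixedPoints {X : SchOver k} (gm : GmAction X) : Set X.left :=
  {p | ∃ x : KPoint X, gm.IsFixed x ∧ x.pos = p}

/-- `W` is an open stratum of the Białynicki-Birula stratification: `W` is open, and there is a
connected component `F` of the fixed locus such that the `k`-rational points of `W` are the `x`
for which `lim_{t → 0} t.x` exists and lies in `F`. -/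
def GmAction.IsOpenStratum {X : SchOver k} (gm : GmAction X) (W : Set X.left) : Prop :=
  IsOpen W ∧ ∃ p ∈ gm.fixedPoints, ∀ x : KPoint X,
    x.pos ∈ W ↔ ∃ y : KPoint X, y.pos ∈ connectedComponentIn gm.fixedPoints p ∧ gm.HasLimit x y

end Actions

/-! ### Affine cones with an action of `𝔾ₐ^r ⋊_w 𝔾ₘ` -/

/-- A variety over `k`: an integral (in particular non-empty) scheme, separated and of finite type
over `k`. -/
structure IsVariety {k : Type u} [Field k] (X : SchOver k) : Prop where
  isIntegral : IsIntegral X.left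
  isSeparated : IsSeparated X.hom
  locallyOfFiniteType : LocallyOfFiniteType X.hom
  quasiCompact : QuasiCompact X.hom

/-- An affine cone of varieties `π : C ⟶ S` with an action of `𝔾ₐ^r ⋊_w 𝔾ₘ` for which `π` is
invariant. The grading `π_* 𝒪_C = ⨁ 𝒜ₙ` with `𝒜₀ = 𝒪_S` is the one by the weights of `𝔾ₘ`. -/
structure Cone (k : Type u) [Field k] (r w : ℕ) where
  C : SchOver k
  S : SchOver k
  π : C ⟶ S
  isVariety_C : IsVariety C
  isVariety_S : IsVariety S
  isAffineHom : IsAffineHom π.left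
  ga : GaAction r C
  gm : GmAction C
  semidirect : IsSemidirect w ga gm
  ga_invariant : ∀ {T : SchOver k} (u : Fin r → Γ(T.left, ⊤)) (x : T ⟶ C), ga.act u x ≫ π = x ≫ π
  gm_invariant : ∀ {T : SchOver k} (t : (Γ(T.left, ⊤))ˣ) (x : T ⟶ C), gm.act t x ≫ π = x ≫ π
  isInternal : ∀ U : S.left.affineOpens,
    DirectSum.IsInternal fun n : ℕ ↦ gm.weight (π.left ⁻¹ᵁ U) n
  app_injective : ∀ U : S.left.affineOpens, Function.Injective (π.left.app U).hom
  weight_zero : ∀ U : S.left.affineOpens,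
    gm.weight (π.left ⁻¹ᵁ U) 0 = (π.left.app U).hom.range.toAddSubgroup

namespace Cone

variable {k : Type u} [Field k] {r w : ℕ} (X : Cone k r w)

/-- The algebra `𝒜(U) = Γ(π⁻¹ U, 𝒪_C)`. -/
abbrev alg (U : X.S.left.affineOpens) : CommRingCat.{u} := Γ(X.C.left, X.π.left ⁻¹ᵁ U)

/-- The ideal `𝒜_{>0}(U)`. -/
def posIdeal (U : X.S.left.affineOpens) : Ideal (X.alg U) :=
  Ideal.span {f | ∃ n : ℕ, 0 < n ∧ f ∈ X.gm.weight (X.π.left ⁻¹ᵁ U) n}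

/-- The `k`-rational points of the zero section `Z`, the closed subscheme cut out by `𝒜_{>0}`. -/
def zeroSection : Set (KPoint X.C) :=
  {z | ∀ (U : X.S.left.affineOpens) (h : ⊤ ≤ z.left ⁻¹ᵁ (X.π.left ⁻¹ᵁ U)),
    ∀ f ∈ X.posIdeal U, (z.left.appLE _ ⊤ h).hom f = 0}

/-- `dim Stab_𝔲(x)`. -/
def dimStab (x : KPoint X.C) : ℕ := Module.finrank k (X.ga.lieStab x)

/-- `d(π)`, the minimum of `dim Stab_𝔲(z)` over the points `z` of the zero section. -/
def d : ℕ := sInf (X.dimStab '' X.zeroSection)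

/-! ### The co-action and the module `𝒬(π)` -/

lemma isAffineOpen_preimage (U : X.S.left.affineOpens) : IsAffineOpen (X.π.left ⁻¹ᵁ U) :=
  haveI := X.isAffineHom
  U.2.preimage X.π.left

/-- The projection `𝔾ₐ^r × π⁻¹ U → π⁻¹ U ⊆ C`, where `𝔾ₐ^r × π⁻¹ U = Spec 𝒜(U)[u₁, …, u_r]`. -/
def proj (U : X.S.left.affineOpens) :
    Spec (.of (MvPolynomial (Fin r) (X.alg U))) ⟶ X.C.left :=
  Spec.map (CommRingCat.ofHom MvPolynomial.C) ≫ (X.isAffineOpen_preimage U).fromSpec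

/-- The `k`-scheme `𝔾ₐ^r × π⁻¹ U`. -/
abbrev prodOver (U : X.S.left.affineOpens) : SchOver k := Over.mk (X.proj U ≫ X.C.hom)

/-- The projection `𝔾ₐ^r × π⁻¹ U → C` over `k`. -/
abbrev projOver (U : X.S.left.affineOpens) : X.prodOver U ⟶ X.C := Over.homMk (X.proj U)

/-- The action morphism `𝔾ₐ^r × π⁻¹ U → C`, `(u, x) ↦ u.x`. -/
def action (U : X.S.left.affineOpens) : X.prodOver U ⟶ X.C :=
  X.ga.act (T := X.prodOver U)
    (fun i ↦ specFun (R := .of (MvPolynomial (Fin r) (X.alg U))) (MvPolynomial.X i))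
    (X.projOver U)

lemma top_le_action (U : X.S.left.affineOpens) :
    ⊤ ≤ (X.action U).left ⁻¹ᵁ (X.π.left ⁻¹ᵁ U) := by
  have h : (X.action U).left ≫ X.π.left = X.proj U ≫ X.π.left := by
    have := X.ga_invariant (T := X.prodOver U)
      (fun i ↦ specFun (R := .of (MvPolynomial (Fin r) (X.alg U))) (MvPolynomial.X i))
      (X.projOver U)
    exact congr($(this).left)
  rw [← Scheme.Hom.comp_preimage, h]
  intro p _
  simp [proj]

/-- The co-action `𝒜(U) → 𝒜(U)[u₁, …, u_r] = 𝒪(𝔾ₐ^r) ⊗ 𝒜(U)`. -/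
def coaction (U : X.S.left.affineOpens) : X.alg U →+* MvPolynomial (Fin r) (X.alg U) :=
  ((X.action U).left.appLE (X.π.left ⁻¹ᵁ U) ⊤ (X.top_le_action U) ≫
    (Scheme.ΓSpecIso (.of (MvPolynomial (Fin r) (X.alg U)))).hom).hom

lemma constantCoeff_coaction (U : X.S.left.affineOpens) (f : X.alg U) :
    MvPolynomial.constantCoeff (X.coaction U f) = f := by
  have hV := X.isAffineOpen_preimage U
  let e : MvPolynomial (Fin r) (X.alg U) →+* X.alg U := MvPolynomial.constantCoeff
  let s : Spec (X.alg U) ⟶ Spec (.of (MvPolynomial (Fin r) (X.alg U))) :=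
    Spec.map (CommRingCat.ofHom e)
  have hs : s ≫ X.proj U = hV.fromSpec := by
    rw [proj, ← Category.assoc, ← Spec.map_comp, ← CommRingCat.ofHom_comp,
      show e.comp MvPolynomial.C = RingHom.id _ from RingHom.ext fun a ↦ by simp [e]]
    exact (congr_arg (· ≫ _) (Spec.map_id (X.alg U))).trans (Category.id_comp _)
  let s' : Over.mk (hV.fromSpec ≫ X.C.hom) ⟶ X.prodOver U :=
    Over.homMk s (by simp only [Over.mk_hom, ← hs, Category.assoc])
  have h1 : s' ≫ X.action U = s' ≫ X.projOver U := by
    rw [action, X.ga.naturality]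
    convert! X.ga.act_zero (s' ≫ X.projOver U) using 2
    funext i
    have h3 := Scheme.ΓSpecIso_inv_naturality (CommRingCat.ofHom e)
    have h4 := congr($(h3).hom (MvPolynomial.X i))
    simp only [CommRingCat.hom_comp, RingHom.comp_apply] at h4
    refine h4.symm.trans ?_
    simp [e]
  have h2 : s ≫ (X.action U).left = hV.fromSpec := by
    rw [← hs]
    exact congr($(h1).left)
  have h5 : (X.action U).left.appLE (X.π.left ⁻¹ᵁ U) ⊤ (X.top_le_action U) ≫ s.appTop =
      (Scheme.ΓSpecIso _).inv := by
    have h6 : ∀ (g : Spec (X.alg U) ⟶ X.C.left) (_ : g = hV.fromSpec)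
        (hg : ⊤ ≤ g ⁻¹ᵁ (X.π.left ⁻¹ᵁ U)), g.appLE _ ⊤ hg = (Scheme.ΓSpecIso _).inv := by
      rintro g rfl hg
      rw [Scheme.Hom.appLE, hV.fromSpec_app_self, Category.assoc, ← Functor.map_comp]
      exact (congr_arg _ (CategoryTheory.Functor.map_id _ _)).trans (Category.comp_id _)
    rw [← h6 _ h2 (fun p _ ↦ X.top_le_action U (Set.mem_univ (s p))),
      ← Scheme.Hom.appLE_comp_appLE s (X.action U).left (X.π.left ⁻¹ᵁ U) ⊤ ⊤
        (X.top_le_action U) le_rfl]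
    exact congr_arg _ (Scheme.Hom.app_eq_appLE s)
  have h7 : (Scheme.ΓSpecIso (.of (MvPolynomial (Fin r) (X.alg U)))).hom ≫
      CommRingCat.ofHom e = s.appTop ≫ (Scheme.ΓSpecIso (X.alg U)).hom :=
    (Scheme.ΓSpecIso_naturality (CommRingCat.ofHom e)).symm
  have h8 : ((X.action U).left.appLE (X.π.left ⁻¹ᵁ U) ⊤ (X.top_le_action U) ≫
      (Scheme.ΓSpecIso (.of (MvPolynomial (Fin r) (X.alg U)))).hom) ≫ CommRingCat.ofHom e =
        𝟙 _ := by
    rw [Category.assoc, h7, ← Category.assoc, h5, Iso.inv_hom_id]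
  exact congr($(h8).hom f)

lemma coaction_app (U : X.S.left.affineOpens) (a : Γ(X.S.left, U)) :
    X.coaction U ((X.π.left.app U).hom a) = MvPolynomial.C ((X.π.left.app U).hom a) := by
  have hV := X.isAffineOpen_preimage U
  have h6 : ∀ (g : X.prodOver U ⟶ X.C) (_ : g.left ≫ X.π.left = X.proj U ≫ X.π.left)
      (hg : ⊤ ≤ g.left ⁻¹ᵁ (X.π.left ⁻¹ᵁ U)) (hg' : ⊤ ≤ X.proj U ⁻¹ᵁ (X.π.left ⁻¹ᵁ U)),
      X.π.left.app U ≫ g.left.appLE _ ⊤ hg = X.π.left.app U ≫ (X.proj U).appLE _ ⊤ hg' := by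
    intro g h hg hg'
    rw [Scheme.Hom.app_eq_appLE, Scheme.Hom.appLE_comp_appLE, Scheme.Hom.appLE_comp_appLE]
    simp only [h]
  have h7 : X.π.left.app U ≫ (X.action U).left.appLE _ ⊤ (X.top_le_action U) =
      X.π.left.app U ≫ (X.proj U).appLE _ ⊤ (by intro p _; simp [proj]) := by
    apply h6
    have := X.ga_invariant (T := X.prodOver U)
      (fun i ↦ specFun (R := .of (MvPolynomial (Fin r) (X.alg U))) (MvPolynomial.X i))
      (X.projOver U)
    exact congr($(this).left)
  have h8 : (X.proj U).appLE (X.π.left ⁻¹ᵁ U) ⊤ (by intro p _; simp [proj]) ≫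
      (Scheme.ΓSpecIso (.of (MvPolynomial (Fin r) (X.alg U)))).hom =
        CommRingCat.ofHom MvPolynomial.C := by
    have h9 : hV.fromSpec.appLE (X.π.left ⁻¹ᵁ U) ⊤ hV.fromSpec_preimage_self.ge =
        (Scheme.ΓSpecIso _).inv := by
      rw [Scheme.Hom.appLE, hV.fromSpec_app_self, Category.assoc, ← Functor.map_comp]
      exact (congr_arg _ (CategoryTheory.Functor.map_id _ _)).trans (Category.comp_id _)
    have h10 := Scheme.Hom.appLE_comp_appLE
      (Spec.map (CommRingCat.ofHom (MvPolynomial.C (σ := Fin r) (R := X.alg U))))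
      hV.fromSpec (X.π.left ⁻¹ᵁ U) ⊤ ⊤ hV.fromSpec_preimage_self.ge le_rfl
    rw [h9] at h10
    refine (congr_arg (· ≫ _) h10.symm).trans ?_
    have h11 := Scheme.ΓSpecIso_naturality
      (CommRingCat.ofHom (MvPolynomial.C (σ := Fin r) (R := X.alg U)))
    rw [Category.assoc, Iso.inv_comp_eq]
    refine Eq.trans ?_ h11
    exact congr_arg (· ≫ _) (Scheme.Hom.app_eq_appLE _).symm
  have h12 := congr($(h7) ≫ (Scheme.ΓSpecIso (.of (MvPolynomial (Fin r) (X.alg U)))).hom)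
  rw [Category.assoc, Category.assoc, h8] at h12
  exact congr($(h12).hom a)

/-- `𝒜(U)` is an algebra over `𝒜₀(U) = Γ(U, 𝒪_S)`. -/
instance algebraAlg (U : X.S.left.affineOpens) : Algebra Γ(X.S.left, U) (X.alg U) :=
  (X.π.left.app U).hom.toAlgebra

/-- The vector field of the `i`-th basis vector `ξᵢ` of `𝔲`: the composition of the co-action,
of `∂ / ∂uᵢ`, and of `u₁ = ⋯ = u_r = 0`. -/
def vectorField (U : X.S.left.affineOpens) (i : Fin r) :
    Derivation Γ(X.S.left, U) (X.alg U) (X.alg U) :=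
  Derivation.mk'
    { toFun := fun f ↦ MvPolynomial.constantCoeff (MvPolynomial.pderiv i (X.coaction U f))
      map_add' := fun f g ↦ by simp only [map_add]
      map_smul' := fun a f ↦ by
        rw [Algebra.smul_def, map_mul, RingHom.algebraMap_toAlgebra, coaction_app,
          Derivation.leibniz, MvPolynomial.pderiv_C]
        simp [Algebra.smul_def, RingHom.algebraMap_toAlgebra] }
    (fun f g ↦ by
      simp only [LinearMap.coe_mk, AddHom.coe_mk, map_mul, Derivation.leibniz, map_add,
        smul_eq_mul, constantCoeff_coaction])

/-- The morphism `Ω_{𝒜/𝒜₀} → 𝔲^* ⊗ 𝒜 = 𝒜^r` over `U`, sending `df` to `(ξ₁.f, …, ξ_r.f)`. -/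
def conormalMap (U : X.S.left.affineOpens) :
    Ω[X.alg U⁄Γ(X.S.left, U)] →ₗ[X.alg U] (Fin r → X.alg U) :=
  LinearMap.pi fun i ↦ (X.vectorField U i).liftKaehlerDifferential

/-- The module `𝒬(π)` over `U`, the cokernel of `Ω_{𝒜/𝒜₀} → 𝔲^* ⊗ 𝒜`. -/
abbrev Q (U : X.S.left.affineOpens) : Type u :=
  (Fin r → X.alg U) ⧸ LinearMap.range (X.conormalMap U)

end Cone

/-- The `d`-th Fitting ideal of a finitely generated module `M`, computed from a surjection
`φ : R ^ n → M`: it is generated by the minors of size `n - d` of the relations. (For `d ≥ n` it is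
the unit ideal, generated by the empty determinant.) -/
def fittingIdeal {R M : Type*} [CommRing R] [AddCommGroup M] [Module R M] {n : ℕ}
    (φ : (Fin n → R) →ₗ[R] M) (d : ℕ) : Ideal R :=
  Ideal.span {a | ∃ (v : Fin (n - d) → LinearMap.ker φ) (s : Fin (n - d) → Fin n),
    a = (Matrix.of fun i j ↦ (v i : Fin n → R) (s j)).det}

/-! ### The centre of the modification -/

namespace Cone

variable {k : Type u} [Field k] {r w : ℕ} (X : Cone k r w)

/-- The Fitting ideal `Fit_d(𝒬(π))` over `U`. -/
def fit (U : X.S.left.affineOpens) (d : ℕ) : Ideal (X.alg U) :=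
  fittingIdeal (LinearMap.range (X.conormalMap U)).mkQ d

/-- The ideal `ℐ = Fit_{d(π)}(𝒬(π)) + 𝒜_{>0}` of the closed subscheme `Z ∖ Z^reg` of `C`, where
`Z^reg` is the locus where `dim Stab_𝔲 = d(π)`. -/
def singIdeal (U : X.S.left.affineOpens) : Ideal (X.alg U) :=
  X.fit U X.d ⊔ X.posIdeal U

/-- The ideal `𝒥 = ker(𝒜 → 𝒪(𝔾ₐ^r) ⊗ 𝒜/ℐ)` of the closure of `𝔾ₐ^r.(Z ∖ Z^reg)`, the scheme
theoretic image of `𝔾ₐ^r × (Z ∖ Z^reg) → C`. -/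
def centreIdeal (U : X.S.left.affineOpens) : Ideal (X.alg U) :=
  RingHom.ker ((MvPolynomial.map (Ideal.Quotient.mk (X.singIdeal U))).comp (X.coaction U))

/-! ### Blowing up and modifications -/

/-- The inverse image ideal `f⁻¹ 𝒥 · 𝒪_Y` of a quasi-coherent ideal `𝒥` of `𝒜 = π_* 𝒪_C` is
invertible: locally it is generated by one function that is not a zero divisor. -/
def InverseImageInvertible (J : ∀ U : X.S.left.affineOpens, Ideal (X.alg U)) {Y : Scheme.{u}}
    (f : Y ⟶ X.C.left) : Prop :=
  ∀ y : Y, ∃ (U : X.S.left.affineOpens) (V : Y.affineOpens)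
    (h : V.1 ≤ f ⁻¹ᵁ (X.π.left ⁻¹ᵁ U)), y ∈ V.1 ∧
    ∃ g ∈ nonZeroDivisors Γ(Y, V), (J U).map (f.appLE _ V h).hom = Ideal.span {g}

/-- `b : B ⟶ C` is the blowing up of `C` in the closed subscheme cut out by `𝒥`, by the universal
property: `b` is final among the morphisms along which the inverse image of `𝒥` is invertible. -/
def IsBlowup (J : ∀ U : X.S.left.affineOpens, Ideal (X.alg U)) {B : Scheme.{u}}
    (b : B ⟶ X.C.left) : Prop :=
  X.InverseImageInvertible J b ∧
  ∀ (Y : Scheme.{u}) (f : Y ⟶ X.C.left), X.InverseImageInvertible J f → ∃! g : Y ⟶ B, g ≫ b = f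

/-- `X'`, that is `π' : C' ⟶ S'`, is the modification of `X`, that is of `π : C ⟶ S`, whose centre
is cut out by `𝒥`: there are
* the blowing up `b : B ⟶ C` with the action of `𝔾ₘ` on `B` for which `b` is equivariant,
* a `𝔾ₘ`-equivariant open immersion `j : C' ⟶ B` onto the open stratum of the Białynicki-Birula
  stratification of `B`, such that `p = b ∘ j` is `𝔾ₐ^r`-equivariant,
* and `q : S' ⟶ S` with `q ∘ π' = π ∘ p`. -/
def IsModification (J : ∀ U : X.S.left.affineOpens, Ideal (X.alg U)) (X' : Cone k r w) : Prop :=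
  ∃ (B : SchOver k) (b : B ⟶ X.C) (gmB : GmAction B) (j : X'.C ⟶ B) (q : X'.S ⟶ X.S),
    X.IsBlowup J b.left ∧
    (∀ {T : SchOver k} (t : (Γ(T.left, ⊤))ˣ) (x : T ⟶ B),
      gmB.act t x ≫ b = X.gm.act t (x ≫ b)) ∧
    IsOpenImmersion j.left ∧
    gmB.IsOpenStratum (Set.range j.left) ∧
    (∀ {T : SchOver k} (t : (Γ(T.left, ⊤))ˣ) (x : T ⟶ X'.C),
      X'.gm.act t x ≫ j = gmB.act t (x ≫ j)) ∧
    (∀ {T : SchOver k} (u : Fin r → Γ(T.left, ⊤)) (x : T ⟶ X'.C),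
      X'.ga.act u x ≫ j ≫ b = X.ga.act u (x ≫ j ≫ b)) ∧
    X'.π ≫ q = (j ≫ b) ≫ X.π

end Cone

end AdditiveCone

end

/-! The vector fields of `𝔲` lower weights by `w`, and functions of positive weight vanish on the
zero section. So at a point `z` of `Z` only functions `h` of weight `w` can have non-zero
derivatives. These derivatives `ξᵢ.h` are functions on `S`, and `Stab_𝔲(z)` is the orthogonal
complement of the vectors `(ξᵢ.h)(z)` (`lieStab_eq_orthogonal`). Put `m = r - d(π)`. Modulo `𝒜_{>0}`
the ideal `ℐ` is generated by the minors of size `m` of the matrices `(ξⱼ.hᵢ)`. Being invariant,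
these minors lie in `𝒥`, and they generate its weight zero part (`derivMinors_subset_centreIdeal`,
`proj_zero_mem_span_derivMinors`). Moreover, a function `g` of weight `w` lies in `𝒥` as soon as all
`ξᵢ.g` do, because its co-action is `g + ∑ uᵢ ξᵢ.g` (`mem_centreIdeal_of_vectorField_mem`).

Upper bound (`exists_minor_ne_zero_of_generatesAt`). At `z' ∈ Z'` the inverse image of `𝒥` is
principal; by the grading and Nakayama it is generated there by a single minor `δ = det M`. Cramer's
rule combines the functions whose derivatives form `M` into `gₐ` of weight `w` whose derivative
along the `b`-th chosen field is `δ` if `a = b` and `0` otherwise. All derivatives of `gₐ` are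
minors, hence `gₐ ∈ 𝒥`, and `gₐ / δ` is regular at `z'`. The derivatives of these quotients form an
identity matrix of size `m`, so the stabiliser of `z'` has dimension at most `r - m = d(π)`.

Lower bound. Where a minor in `𝒥` is invertible, the blowing up is a monomorphism, so the stabiliser
of a point of `Z'` contains that of its image in `Z`, which has dimension at least `d(π)`
(`dimStab_comp_le`). A non-zero minor stays non-zero on `C'`, as the blowing up is dominant
(`IsBlowup.exists_mem_of_nonempty`). So this locus is dense in the irreducible `S'`, and upper
semi-continuity (`exists_dimStab_add_le`) gives the bound everywhere. -/

noncomputable section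

namespace AdditiveCone

/-! ### Linear algebra -/

/-- The vectors that are orthogonal to all `v` in a set of vectors. -/
def orthogonal {k : Type*} [Field k] {r : ℕ} (V : Set (Fin r → k)) : Submodule k (Fin r → k) where
  carrier := {ξ | ∀ v ∈ V, ∑ i, ξ i * v i = 0}
  zero_mem' := by simp
  add_mem' := by
    intro a b ha hb v hv
    simp [add_mul, Finset.sum_add_distrib, ha v hv, hb v hv]
  smul_mem' := by
    intro c a ha v hv
    simp [mul_assoc, ← Finset.mul_sum, ha v hv]

lemma mem_orthogonal {k : Type*} [Field k] {r : ℕ} {V : Set (Fin r → k)} {ξ : Fin r → k} :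
    ξ ∈ orthogonal V ↔ ∀ v ∈ V, ∑ i, ξ i * v i = 0 := Iff.rfl

/-- A non-vanishing minor of size `n` bounds the dimension of the orthogonal complement. -/
lemma finrank_orthogonal_add_le {k : Type*} [Field k] {r n : ℕ} {V : Set (Fin r → k)}
    (v : Fin n → Fin r → k) (hv : ∀ i, v i ∈ V) (s : Fin n → Fin r)
    (h : (Matrix.of fun i j ↦ v i (s j)).det ≠ 0) :
    Module.finrank k (orthogonal V) + n ≤ r := by
  let M : Matrix (Fin n) (Fin r) k := Matrix.of v
  have hle : orthogonal V ≤ LinearMap.ker M.mulVecLin := by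
    intro ξ hξ
    rw [LinearMap.mem_ker]
    funext a
    simpa [M, Matrix.mulVec, dotProduct, mul_comm] using hξ (v a) (hv a)
  have h1 := Submodule.finrank_mono hle
  have h2 := LinearMap.finrank_range_add_finrank_ker M.mulVecLin
  have h3 : n ≤ M.rank := by
    have h4 : (M.submatrix id s).rank = n := by
      rw [Matrix.rank_of_isUnit, Fintype.card_fin]
      exact (Matrix.isUnit_iff_isUnit_det _).2 (isUnit_iff_ne_zero.2 h)
    exact h4.symm.le.trans (Matrix.rank_submatrix_le _ _ _)
  simp only [Module.finrank_fin_fun] at h2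
  rw [Matrix.rank] at h3
  omega

/-- If the orthogonal complement of `V` is small then `V` has a non-vanishing minor. -/
lemma exists_minor_ne_zero {k : Type*} [Field k] {r n : ℕ} {V : Set (Fin r → k)}
    (h : Module.finrank k (orthogonal V) + n ≤ r) :
    ∃ (v : Fin n → Fin r → k) (_ : ∀ i, v i ∈ V) (s : Fin n → Fin r),
      (Matrix.of fun i j ↦ v i (s j)).det ≠ 0 := by
  obtain ⟨f, hf, hspan, hli⟩ := Submodule.exists_fun_fin_finrank_span_eq k V
  have h1 : n ≤ Module.finrank k (Submodule.span k V) := by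
    let M : Matrix (Fin (Module.finrank k (Submodule.span k V))) (Fin r) k := Matrix.of f
    have h2 := LinearMap.finrank_range_add_finrank_ker M.mulVecLin
    have h3 : LinearMap.ker M.mulVecLin ≤ orthogonal V := by
      intro ξ hξ v hv
      have h4 : Submodule.span k (Set.range f) ≤ LinearMap.ker (dotProductBilin k k ξ) := by
        rw [Submodule.span_le]
        rintro _ ⟨a, rfl⟩
        have := congr_fun (LinearMap.mem_ker.1 hξ) a
        simpa [M, Matrix.mulVec, dotProduct_comm] using this
      have h5 := h4 (hspan ▸ Submodule.subset_span hv)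
      simpa [dotProduct] using h5
    have h4 := Submodule.finrank_mono h3
    have h5 := M.rank_le_height
    simp only [Module.finrank_fin_fun] at h2
    rw [Matrix.rank] at h5
    omega
  let M : Matrix (Fin n) (Fin r) k := Matrix.of (f ∘ Fin.castLE h1)
  have hM : LinearIndependent k M.row := hli.comp _ (Fin.castLE_injective h1)
  have hr : M.rank = n := by rw [LinearIndependent.rank_matrix hM, Fintype.card_fin]
  -- The `n` chosen rows are independent; column rank equals row rank, so `n` of the columns are
  -- independent too.
  obtain ⟨g, hg, -, hgli⟩ := Submodule.exists_fun_fin_finrank_span_eq k (Set.range M.col)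
  rw [Matrix.rank_eq_finrank_span_cols] at hr
  choose s hs using hg
  let e : Fin n ≃ Fin (Module.finrank k (Submodule.span k (Set.range M.col))) := finCongr hr.symm
  refine ⟨f ∘ Fin.castLE h1, fun i ↦ hf _, s ∘ e, ?_⟩
  rw [← isUnit_iff_ne_zero, ← Matrix.isUnit_iff_isUnit_det,
    ← Matrix.linearIndependent_cols_iff_isUnit]
  convert! hgli.comp e e.injective using 1
  funext i
  exact hs (e i)

/-! ### Ideals in graded rings that are locally principal at a point -/

section Algebra

variable {A A' k : Type*} [CommRing A] [CommRing A'] [Field k]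

/-- The element `f` generates the extension of the ideal `J` along `φ : A → A'` at the point
`ev : A' → k`. -/
def GeneratesAt (φ : A →+* A') (ev : A' →+* k) (J : Ideal A) (f : A) : Prop :=
  ∀ a ∈ J, ∃ s c, ev s ≠ 0 ∧ s * φ a = c * φ f

/-- Nakayama's lemma at the point `ev`: if no `t ∈ T` generates, then every `t` is a multiple of `f`
with a coefficient vanishing at `ev`, hence so is `f` itself. -/
lemma GeneratesAt.exists_of_mem_span [IsDomain A'] {φ : A →+* A'} {ev : A' →+* k} {J : Ideal A}
    {f : A} (hf : GeneratesAt φ ev J f) (hφ : φ f ≠ 0) {T : Set A} (hT : T ⊆ J)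
    (hfT : f ∈ Ideal.span T) : ∃ t ∈ T, GeneratesAt φ ev J t := by
  by_contra! hcon
  have h : ∀ a ∈ Ideal.span T, ∃ s c, ev s ≠ 0 ∧ ev c = 0 ∧ s * φ a = c * φ f := by
    intro a ha
    induction ha using Submodule.span_induction with
    | mem t ht =>
      obtain ⟨s, c, hs, h⟩ := hf t (hT ht)
      -- If `c` did not vanish at the point, `f` would be a multiple of `t` there and `t` would
      -- generate.
      refine ⟨s, c, hs, by_contra fun hc ↦ hcon t ht fun a ha ↦ ?_, h⟩
      obtain ⟨s', c', hs', h'⟩ := hf a ha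
      exact ⟨c * s', c' * s, by simp [hc, hs'], by linear_combination c * h' - c' * h⟩
    | zero => exact ⟨1, 0, by simp, by simp, by simp⟩
    | add a b _ _ ha hb =>
      obtain ⟨s, c, hs, hc, h⟩ := ha
      obtain ⟨s', c', hs', hc', h'⟩ := hb
      exact ⟨s * s', s' * c + s * c', by simp [hs, hs'], by simp [hc, hc'], by
        rw [map_add]; linear_combination s' * h + s * h'⟩
    | smul x a _ ha =>
      obtain ⟨s, c, hs, hc, h⟩ := ha
      exact ⟨s, φ x * c, hs, by simp [hc], by
        rw [smul_eq_mul, map_mul]; linear_combination φ x * h⟩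
  obtain ⟨s, c, hs, hc, h⟩ := h f hfT
  exact hs (by rw [mul_right_cancel₀ hφ h, hc])

/-! ### Weight components and generators of weight zero -/

variable (𝒜 : ℕ → AddSubgroup A) [GradedRing 𝒜] (𝒜' : ℕ → AddSubgroup A') [GradedRing 𝒜']

lemma map_proj {φ : A →+* A'} (hφ : ∀ n, ∀ a ∈ 𝒜 n, φ a ∈ 𝒜' n) (n : ℕ) (a : A) :
    φ (GradedRing.proj 𝒜 n a) = GradedRing.proj 𝒜' n (φ a) := by
  classical
  induction a using DirectSum.Decomposition.inductionOn 𝒜 with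
  | zero => simp
  | add a b ha hb => simp only [map_add, ha, hb]
  | homogeneous a =>
    rename_i i
    simp only [GradedRing.proj_apply]
    by_cases h : i = n
    · subst h
      rw [DirectSum.decompose_of_mem_same _ a.2, DirectSum.decompose_of_mem_same _ (hφ _ _ a.2)]
    · rw [DirectSum.decompose_of_mem_ne _ a.2 h, DirectSum.decompose_of_mem_ne _ (hφ _ _ a.2) h,
        map_zero]

lemma proj_mul_of_right_mem (n : ℕ) (a : A) {b : A} (hb : b ∈ 𝒜 n) :
    GradedRing.proj 𝒜 n (a * b) = GradedRing.proj 𝒜 0 a * b := by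
  have h := DirectSum.coe_decompose_mul_add_of_right_mem 𝒜 (i := 0) (a := a) hb
  rwa [zero_add] at h

lemma proj_mul_of_right_mem_zero (n : ℕ) (a : A) {b : A} (hb : b ∈ 𝒜 0) :
    GradedRing.proj 𝒜 n (a * b) = GradedRing.proj 𝒜 n a * b :=
  DirectSum.coe_decompose_mul_of_right_mem_zero 𝒜 (i := n) (a := a) hb

lemma proj_mem (n : ℕ) (a : A) : GradedRing.proj 𝒜 n a ∈ 𝒜 n := SetLike.coe_mem _

lemma proj_of_mem {n : ℕ} {a : A} (ha : a ∈ 𝒜 n) : GradedRing.proj 𝒜 n a = a :=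
  DirectSum.decompose_of_mem_same _ ha

lemma proj_zero_mul (a b : A) :
    GradedRing.proj 𝒜 0 (a * b) = GradedRing.proj 𝒜 0 a * GradedRing.proj 𝒜 0 b :=
  map_mul (GradedRing.projZeroRingHom 𝒜) a b

lemma det_mem_zero {m : ℕ} {N : Matrix (Fin m) (Fin m) A} (hN : ∀ i j, N i j ∈ 𝒜 0) :
    N.det ∈ 𝒜 0 := by
  let N' : Matrix (Fin m) (Fin m) (SetLike.GradeZero.subring 𝒜) :=
    Matrix.of fun i j ↦ ⟨N i j, hN i j⟩
  have : N = (SetLike.GradeZero.subring 𝒜).subtype.mapMatrix N' := rfl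
  rw [this, ← RingHom.map_det]
  exact N'.det.2

variable {𝒜 𝒜'}

/-- The point `ev` only sees the weight zero part of a coefficient. Taking weight zero parts in the
relations that express `a₀` and the component `f₀` of `f` by `f` shows that `f₀` does not become
zero and differs from `f` by a factor that is a unit at `ev`. -/
lemma GeneratesAt.proj_zero [IsDomain A'] {φ : A →+* A'} (hφ : ∀ n, ∀ a ∈ 𝒜 n, φ a ∈ 𝒜' n)
    {ev : A' →+* k} (hev : ∀ x, ev (GradedRing.proj 𝒜' 0 x) = ev x) {J : Ideal A}
    (hJ : ∀ a ∈ J, GradedRing.proj 𝒜 0 a ∈ J) {a₀ : A} (ha₀ : a₀ ∈ 𝒜 0) (ha₀J : a₀ ∈ J)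
    (hφa₀ : φ a₀ ≠ 0) {f : A} (hfJ : f ∈ J) (hf : GeneratesAt φ ev J f) :
    φ (GradedRing.proj 𝒜 0 f) ≠ 0 ∧ GeneratesAt φ ev J (GradedRing.proj 𝒜 0 f) := by
  have hne : φ (GradedRing.proj 𝒜 0 f) ≠ 0 := by
    intro h0
    obtain ⟨s, c, hs, h⟩ := hf a₀ ha₀J
    have h1 := congr_arg (GradedRing.proj 𝒜' 0) h
    rw [proj_zero_mul, proj_zero_mul, ← map_proj 𝒜 𝒜' hφ, ← map_proj 𝒜 𝒜' hφ, h0, mul_zero,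
      proj_of_mem 𝒜 ha₀, mul_eq_zero] at h1
    rcases h1 with h1 | h1
    · exact hs (by rw [← hev, h1, map_zero])
    · exact hφa₀ h1
  refine ⟨hne, fun a ha ↦ ?_⟩
  obtain ⟨s, c, hs, h⟩ := hf _ (hJ f hfJ)
  have h1 := congr_arg (GradedRing.proj 𝒜' 0) h
  rw [proj_zero_mul, proj_zero_mul, ← map_proj 𝒜 𝒜' hφ, ← map_proj 𝒜 𝒜' hφ,
    proj_of_mem 𝒜 (proj_mem 𝒜 0 f)] at h1
  have hc : ev c ≠ 0 := by
    rwa [← hev, ← mul_right_cancel₀ hne h1, hev]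
  obtain ⟨s', c', hs', h'⟩ := hf a ha
  exact ⟨c * s', c' * s, by simp [hc, hs'], by linear_combination c * h' - c' * h⟩

variable (𝒜) in
/-- The minors of size `m` of the matrix of the derivatives `D j h` of elements `h` of
degree `w`. -/
def derivMinors {r : ℕ} {R : Type*} [CommRing R] [Algebra R A] (D : Fin r → Derivation R A A)
    (w m : ℕ) : Set A :=
  {δ | ∃ (h : Fin m → A) (s : Fin m → Fin r), (∀ i, h i ∈ 𝒜 w) ∧
    δ = (Matrix.of fun i j ↦ D (s j) (h i)).det}

/-- If the extension of `J` to `A'` is principal at a point of the zero section, and `J` is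
generated in degree `0` by the minors of size `m` of the derivatives of elements of degree `w`,
then some minor of size `m` of the derivatives of elements of `A'` does not vanish there. -/
theorem exists_minor_ne_zero_of_generatesAt [IsDomain A'] {φ : A →+* A'}
    (hφ : ∀ n, ∀ a ∈ 𝒜 n, φ a ∈ 𝒜' n)
    {ev : A' →+* k} (hev : ∀ x, ev (GradedRing.proj 𝒜' 0 x) = ev x) {J : Ideal A}
    (hJ : ∀ a ∈ J, GradedRing.proj 𝒜 0 a ∈ J) {a₀ : A} (ha₀ : a₀ ∈ 𝒜 0) (ha₀J : a₀ ∈ J)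
    (hφa₀ : φ a₀ ≠ 0) {r w m : ℕ} {R R' : Type*} [CommRing R] [CommRing R'] [Algebra R A]
    [Algebra R' A'] {D : Fin r → Derivation R A A} {D' : Fin r → Derivation R' A' A'}
    (hD : ∀ i, ∀ a ∈ 𝒜 0, D i a = 0) (hDw : ∀ i, ∀ a ∈ 𝒜 w, D i a ∈ 𝒜 0)
    (hD' : ∀ i, ∀ a ∈ 𝒜' 0, D' i a = 0) (hφD : ∀ i a, φ (D i a) = D' i (φ a))
    (hspan : ∀ a ∈ J, GradedRing.proj 𝒜 0 a ∈ Ideal.span (derivMinors 𝒜 D w m))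
    (hminors : derivMinors 𝒜 D w m ⊆ J) (hJw : ∀ g ∈ 𝒜 w, (∀ l, D l g ∈ J) → g ∈ J)
    (hgen : ∃ f ∈ J, GeneratesAt φ ev J f) :
    ∃ (c : Fin m → A') (s : Fin m → Fin r),
      (Matrix.of fun i j ↦ ev (D' (s j) (c i))).det ≠ 0 := by
  obtain ⟨f, hfJ, hf⟩ := hgen
  obtain ⟨hne, hf0⟩ := hf.proj_zero hφ hev hJ ha₀ ha₀J hφa₀ hfJ
  obtain ⟨δ, hδ, hδgen⟩ := hf0.exists_of_mem_span hne hminors (hspan f hfJ)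
  have hδ0 : φ δ ≠ 0 := by
    intro h0
    obtain ⟨s, c, hs, h⟩ := hδgen _ (hJ f hfJ)
    rw [h0, mul_zero, mul_eq_zero] at h
    exact h.elim (fun h ↦ hs (by rw [h, map_zero])) hne
  obtain ⟨h, s, hw, rfl⟩ := hδ
  set M : Matrix (Fin m) (Fin m) A := Matrix.of fun i j ↦ D (s j) (h i)
  have hMe : ∀ i j, M i j = D (s j) (h i) := fun _ _ ↦ rfl
  have hadj : ∀ a i, M.adjugate a i ∈ 𝒜 0 := by
    intro a i
    rw [Matrix.adjugate_apply]
    refine det_mem_zero 𝒜 fun x y ↦ ?_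
    rw [Matrix.updateRow_apply]
    split_ifs
    · rw [Pi.single_apply]
      split_ifs
      · exact SetLike.GradedOne.one_mem
      · exact zero_mem _
    · exact hDw _ _ (hw x)
  -- Cramer's rule: the adjugate has entries of degree `0`, which the derivations treat as
  -- constants, so it diagonalises the matrix of derivatives along the fields `s b`.
  let g : Fin m → A := fun a ↦ ∑ i, M.adjugate a i * h i
  have hg : ∀ a, g a ∈ 𝒜 w := fun a ↦ sum_mem fun i _ ↦ by
    simpa using SetLike.GradedMul.mul_mem (hadj a i) (hw i)
  have hDg : ∀ l a, D l (g a) = (M.updateCol a fun i ↦ D l (h i)).det := by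
    intro l a
    rw [← Matrix.cramer_apply, Matrix.cramer_eq_adjugate_mulVec]
    simp [g, map_sum, Derivation.leibniz, hD l _ (hadj a _), Matrix.mulVec, dotProduct]
  have hDgs : ∀ b a, D (s b) (g a) = if a = b then M.det else 0 := by
    intro b a
    have h1 := congr_fun (congr_fun M.adjugate_mul a) b
    simp only [Matrix.smul_apply, Matrix.one_apply, smul_eq_mul, mul_ite, mul_one, mul_zero] at h1
    rw [← h1, Matrix.mul_apply]
    simp [g, map_sum, Derivation.leibniz, hD _ _ (hadj a _), hMe]
  -- Differentiating `g a` along `l` replaces column `a` of `M` by the derivatives along `l`: this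
  -- is the minor for `s` with `s a` changed to `l`.
  have hgJ : ∀ a, g a ∈ J := by
    refine fun a ↦ hJw _ (hg a) fun l ↦ hminors ⟨h, Function.update s a l, hw, ?_⟩
    rw [hDg]
    congr 1
    ext i j
    rw [Matrix.updateCol_apply]
    by_cases hj : j = a
    · subst hj; simp
    · simp [hj, hMe]
  choose t c ht hc using fun a ↦ hδgen (g a) (hgJ a)
  have hdet : φ M.det ∈ 𝒜' 0 := hφ _ _ (det_mem_zero 𝒜 fun i j ↦ hDw _ _ (hw i))
  -- The degree `w` part of `t a * φ (g a) = c a * φ M.det`; now the factors `t a` and `φ M.det` are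
  -- replaced by elements of degree `0`, killed by `D'`.
  have hcw : ∀ a, GradedRing.proj 𝒜' 0 (t a) * φ (g a) = GradedRing.proj 𝒜' w (c a) * φ M.det := by
    intro a
    rw [← proj_mul_of_right_mem 𝒜' w _ (hφ _ _ (hg a)), hc,
      proj_mul_of_right_mem_zero 𝒜' w _ hdet]
  -- Differentiate `hcw` and cancel `φ M.det`.
  have hfinal : ∀ a b, D' (s b) (GradedRing.proj 𝒜' w (c a)) =
      if a = b then GradedRing.proj 𝒜' 0 (t a) else 0 := by
    intro a b
    have h1 := congr_arg (D' (s b)) (hcw a)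
    simp only [Derivation.leibniz, hD' _ _ hdet, hD' _ _ (proj_mem 𝒜' 0 _), smul_eq_mul, mul_zero,
      add_zero, zero_add, ← hφD, hDgs] at h1
    apply mul_left_cancel₀ hδ0
    rw [← h1]
    split_ifs
    · rw [mul_comm]
    · simp
  refine ⟨fun a ↦ GradedRing.proj 𝒜' w (c a), s, ?_⟩
  have : (Matrix.of fun i j ↦ ev (D' (s j) (GradedRing.proj 𝒜' w (c i)))) =
      Matrix.diagonal fun a ↦ ev (t a) := by
    ext a b
    simp only [Matrix.of_apply, hfinal, Matrix.diagonal_apply]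
    split_ifs
    · rw [hev]
    · simp
  rw [this, Matrix.det_diagonal]
  exact Finset.prod_ne_zero_iff.2 fun a _ ↦ ht a

end Algebra

/-! ### Morphisms into affine open subschemes -/

lemma toSpecΓ_specMap_appLE_fromSpec {T Y : Scheme.{u}} (x : T ⟶ Y) {U : Y.Opens}
    (hU : IsAffineOpen U) (h : ⊤ ≤ x ⁻¹ᵁ U) :
    T.toSpecΓ ≫ Spec.map (x.appLE U ⊤ h) ≫ hU.fromSpec = x := by
  have h1 := Scheme.Opens.toSpecΓ_SpecMap_appLE x U ⊤ h
  rw [Scheme.Opens.toSpecΓ_top, Category.assoc] at h1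
  have h2 := congr($h1 ≫ hU.fromSpec)
  rw [Category.assoc, Category.assoc, Category.assoc, hU.toSpecΓ_fromSpec, Scheme.Hom.resLE_comp_ι,
    ← Scheme.topIso_hom] at h2
  exact (cancel_epi _).1 h2

lemma hom_ext_of_appLE {T Y : Scheme.{u}} {x y : T ⟶ Y} {U : Y.Opens}
    (hU : IsAffineOpen U) (hx : ⊤ ≤ x ⁻¹ᵁ U) (hy : ⊤ ≤ y ⁻¹ᵁ U)
    (h : ∀ f, (x.appLE U ⊤ hx).hom f = (y.appLE U ⊤ hy).hom f) : x = y := by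
  rw [← toSpecΓ_specMap_appLE_fromSpec x hU hx, ← toSpecΓ_specMap_appLE_fromSpec y hU hy]
  congr 3
  ext f
  exact h f

lemma fromSpec_appLE_self {Y : Scheme.{u}} {U : Y.Opens} (hU : IsAffineOpen U) (h) :
    hU.fromSpec.appLE U ⊤ h = (Scheme.ΓSpecIso _).inv := by
  rw [Scheme.Hom.appLE, hU.fromSpec_app_self, Category.assoc, ← Functor.map_comp]
  exact (congr_arg _ (CategoryTheory.Functor.map_id _ _)).trans (Category.comp_id _)

lemma top_le_specMap_fromSpec {Y : Scheme.{u}} {U : Y.Opens} (hU : IsAffineOpen U)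
    {P : CommRingCat.{u}} (ψ : Γ(Y, U) ⟶ P) : ⊤ ≤ (Spec.map ψ ≫ hU.fromSpec) ⁻¹ᵁ U := by
  intro p _
  simp

lemma specMap_fromSpec_appLE {Y : Scheme.{u}} {U : Y.Opens} (hU : IsAffineOpen U)
    {P : CommRingCat.{u}} (ψ : Γ(Y, U) ⟶ P) (h) :
    (Spec.map ψ ≫ hU.fromSpec).appLE U ⊤ h = ψ ≫ (Scheme.ΓSpecIso P).inv := by
  rw [← Scheme.Hom.appLE_comp_appLE _ _ U ⊤ ⊤ hU.fromSpec_preimage_self.ge le_rfl,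
    fromSpec_appLE_self, Scheme.ΓSpecIso_inv_naturality]
  exact congr_arg _ (Scheme.Hom.app_eq_appLE _).symm

lemma appLE_top {T Y : Scheme.{u}} (x : T ⟶ Y) (h : ⊤ ≤ x ⁻¹ᵁ ⊤) :
    x.appLE ⊤ ⊤ h = x.appTop :=
  (Scheme.Hom.app_eq_appLE _).symm

lemma appLE_comp_apply {T Y Z : Scheme.{u}} (x : T ⟶ Y) (p : Y ⟶ Z) {V : Y.Opens} {U : Z.Opens}
    (hx : ⊤ ≤ x ⁻¹ᵁ V) (hp : V ≤ p ⁻¹ᵁ U) (h : ⊤ ≤ (x ≫ p) ⁻¹ᵁ U) (f : Γ(Z, U)) :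
    ((x ≫ p).appLE U ⊤ h).hom f = (x.appLE V ⊤ hx).hom ((p.appLE U V hp).hom f) := by
  rw [← Scheme.Hom.appLE_comp_appLE x p U V ⊤ hp hx]
  rfl

namespace Cone

variable {k : Type u} [Field k] {r w : ℕ} (X : Cone k r w)

/-! ### The co-action computes the action on points -/

lemma top_le_ga {T : SchOver k} {x : T ⟶ X.C} {U : X.S.left.affineOpens}
    (h : ⊤ ≤ x.left ⁻¹ᵁ (X.π.left ⁻¹ᵁ U)) (u : Fin r → Γ(T.left, ⊤)) :
    ⊤ ≤ (X.ga.act u x).left ⁻¹ᵁ (X.π.left ⁻¹ᵁ U) := by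
  have := congr($(X.ga_invariant u x).left)
  rw [Over.comp_left, Over.comp_left] at this
  rwa [← Scheme.Hom.comp_preimage, this, Scheme.Hom.comp_preimage]

lemma top_le_gm {T : SchOver k} {x : T ⟶ X.C} {U : X.S.left.affineOpens}
    (h : ⊤ ≤ x.left ⁻¹ᵁ (X.π.left ⁻¹ᵁ U)) (t : (Γ(T.left, ⊤))ˣ) :
    ⊤ ≤ (X.gm.act t x).left ⁻¹ᵁ (X.π.left ⁻¹ᵁ U) := by
  have := congr($(X.gm_invariant t x).left)
  rw [Over.comp_left, Over.comp_left] at this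
  rwa [← Scheme.Hom.comp_preimage, this, Scheme.Hom.comp_preimage]

/-- The pair `(u, x)` is a morphism `T ⟶ 𝔾ₐ^r × π⁻¹ U`; by naturality the universal action pulls
back along it to `u.x`. -/
lemma ga_appLE {T : SchOver k} (x : T ⟶ X.C) (U : X.S.left.affineOpens)
    (h : ⊤ ≤ x.left ⁻¹ᵁ (X.π.left ⁻¹ᵁ U)) (u : Fin r → Γ(T.left, ⊤))
    (h' : ⊤ ≤ (X.ga.act u x).left ⁻¹ᵁ (X.π.left ⁻¹ᵁ U)) (f : X.alg U) :
    ((X.ga.act u x).left.appLE _ ⊤ h').hom f =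
      MvPolynomial.eval₂ (x.left.appLE _ ⊤ h).hom u (X.coaction U f) := by
  have hV := X.isAffineOpen_preimage U
  let e : MvPolynomial (Fin r) (X.alg U) →+* Γ(T.left, ⊤) :=
    MvPolynomial.eval₂Hom (x.left.appLE _ ⊤ h).hom u
  let s : T.left ⟶ Spec (.of (MvPolynomial (Fin r) (X.alg U))) :=
    T.left.toSpecΓ ≫ Spec.map (CommRingCat.ofHom e)
  have hs : s ≫ X.proj U = x.left := by
    rw [proj, Category.assoc, ← Spec.map_comp_assoc, ← CommRingCat.ofHom_comp,
      show e.comp MvPolynomial.C = (x.left.appLE _ ⊤ h).hom from RingHom.ext fun a ↦ by simp [e]]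
    exact toSpecΓ_specMap_appLE_fromSpec x.left hV h
  let s' : T ⟶ X.prodOver U := Over.homMk s (by
    change s ≫ X.proj U ≫ X.C.hom = T.hom
    rw [← Category.assoc, hs, Over.w])
  have hsx : s' ≫ X.projOver U = x := by ext1; exact hs
  have hsapp : s.appTop = (Scheme.ΓSpecIso _).hom ≫ CommRingCat.ofHom e := by
    rw [Scheme.Hom.comp_appTop, Scheme.toSpecΓ_appTop]
    exact (Scheme.ΓSpecIso_naturality (CommRingCat.ofHom e))
  have h1 : s' ≫ X.action U = X.ga.act u x := by
    rw [action, X.ga.naturality, hsx]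
    congr 1
    funext i
    change s.appTop.hom _ = _
    rw [hsapp]
    simp [e]
  have h2 : ∀ (y : T ⟶ X.C) (_ : s' ≫ X.action U = y) (h' : ⊤ ≤ y.left ⁻¹ᵁ (X.π.left ⁻¹ᵁ U)),
      (y.left.appLE _ ⊤ h').hom f = e (X.coaction U f) := by
    rintro y rfl h'
    have h3 := appLE_comp_apply s (X.action U).left (V := ⊤) le_rfl (X.top_le_action U) h' f
    refine h3.trans (congr($((appLE_top s le_rfl).trans hsapp).hom _).trans ?_)
    rfl
  exact h2 _ h1 _

/-! ### The grading -/

/-- The grading of `𝒜(U)` by the weights of `𝔾ₘ`. -/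
abbrev gr (U : X.S.left.affineOpens) : ℕ → AddSubgroup (X.alg U) :=
  X.gm.weight (X.π.left ⁻¹ᵁ U)

lemma gm_appLE {T : SchOver k} (x : T ⟶ X.C) (U : X.S.left.affineOpens)
    (h : ⊤ ≤ x.left ⁻¹ᵁ (X.π.left ⁻¹ᵁ U)) (t : (Γ(T.left, ⊤))ˣ)
    (h' : ⊤ ≤ (X.gm.act t x).left ⁻¹ᵁ (X.π.left ⁻¹ᵁ U)) {n : ℕ} {f : X.alg U} (hf : f ∈ X.gr U n) :
    ((X.gm.act t x).left.appLE _ ⊤ h').hom f =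
      (t : Γ(T.left, ⊤)) ^ n * (x.left.appLE _ ⊤ h).hom f :=
  hf T t x h h'

instance gradedMonoid (U : X.S.left.affineOpens) : SetLike.GradedMonoid (X.gr U) where
  one_mem := by
    intro T t x h h'
    simp
  mul_mem := by
    intro m n f g hf hg T t x h h'
    rw [map_mul, map_mul, hf T t x h h', hg T t x h h']
    ring

instance gradedRing (U : X.S.left.affineOpens) : GradedRing (X.gr U) :=
  { X.gradedMonoid U, (X.isInternal U).chooseDecomposition with }

lemma mem_gr_zero {U : X.S.left.affineOpens} {f : X.alg U} :
    f ∈ X.gr U 0 ↔ ∃ a, (X.π.left.app U).hom a = f := by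
  rw [gr, X.weight_zero U]
  rfl

lemma mem_posIdeal {U : X.S.left.affineOpens} {n : ℕ} (hn : 0 < n) {f : X.alg U}
    (hf : f ∈ X.gr U n) : f ∈ X.posIdeal U :=
  Ideal.subset_span ⟨n, hn, hf⟩

lemma sub_proj_zero_mem_posIdeal {U : X.S.left.affineOpens} (f : X.alg U) :
    f - GradedRing.proj (X.gr U) 0 f ∈ X.posIdeal U := by
  classical
  induction f using DirectSum.Decomposition.inductionOn (X.gr U) with
  | zero => simp
  | add a b ha hb =>
    rw [map_add, add_sub_add_comm]
    exact add_mem ha hb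
  | homogeneous a =>
    rename_i n
    rw [GradedRing.proj_apply]
    by_cases hn : n = 0
    · subst hn
      rw [DirectSum.decompose_of_mem_same _ a.2, sub_self]
      exact zero_mem _
    · rw [DirectSum.decompose_of_mem_ne _ a.2 hn, sub_zero]
      exact X.mem_posIdeal (Nat.pos_of_ne_zero hn) a.2

lemma proj_zero_eq_zero_of_mem_posIdeal {U : X.S.left.affineOpens} {f : X.alg U}
    (hf : f ∈ X.posIdeal U) : GradedRing.proj (X.gr U) 0 f = 0 := by
  have h : X.posIdeal U ≤ RingHom.ker (GradedRing.projZeroRingHom (X.gr U)) := by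
    rw [posIdeal, Ideal.span_le]
    rintro f ⟨n, hn, hf⟩
    exact DirectSum.decompose_of_mem_ne _ hf hn.ne'
  exact h hf

/-! ### The degree of the co-action -/

/-- The `k`-scheme `Spec P` over `π⁻¹ U`. -/
abbrev affOver (U : X.S.left.affineOpens) {P : Type u} [CommRing P] (ψ : X.alg U →+* P) :
    SchOver k :=
  Over.mk (Spec.map (CommRingCat.ofHom ψ) ≫ (X.isAffineOpen_preimage U).fromSpec ≫ X.C.hom)

/-- The point of `C` with values in `P` given by a homomorphism `𝒜(U) → P`. -/
abbrev affPoint (U : X.S.left.affineOpens) {P : Type u} [CommRing P] (ψ : X.alg U →+* P) :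
    X.affOver U ψ ⟶ X.C :=
  Over.homMk (Spec.map (CommRingCat.ofHom ψ) ≫ (X.isAffineOpen_preimage U).fromSpec)
    (Category.assoc _ _ _)

lemma top_le_affPoint (U : X.S.left.affineOpens) {P : Type u} [CommRing P] (ψ : X.alg U →+* P) :
    ⊤ ≤ (X.affPoint U ψ).left ⁻¹ᵁ (X.π.left ⁻¹ᵁ U) :=
  top_le_specMap_fromSpec _ _

lemma affPoint_appLE (U : X.S.left.affineOpens) {P : Type u} [CommRing P] (ψ : X.alg U →+* P)
    (h) (f : X.alg U) :
    ((X.affPoint U ψ).left.appLE (X.π.left ⁻¹ᵁ U) ⊤ h).hom f =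
      specFun (R := .of P) (ψ f) :=
  congr($(specMap_fromSpec_appLE (X.isAffineOpen_preimage U) (CommRingCat.ofHom ψ) h).hom f)

lemma specFun_injective (P : CommRingCat.{u}) : Function.Injective (specFun (R := P)) :=
  (Scheme.ΓSpecIso P).symm.commRingCatIsoToRingEquiv.injective

/-! ### Laurent polynomials and the co-action of `𝔾ₘ` -/

lemma coeff_C_mul_T {R : Type*} [CommRing R] (a : R) (m n : ℤ) :
    (LaurentPolynomial.C a * LaurentPolynomial.T m).coeff n = if m = n then a else 0 := by
  rw [← LaurentPolynomial.single_eq_C_mul_T, AddMonoidAlgebra.coeff_single, Finsupp.single_apply]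

lemma coeff_mul_T {R : Type*} [CommRing R] (p : LaurentPolynomial R) (m n : ℤ) :
    (p * LaurentPolynomial.T m).coeff (n + m) = p.coeff n := by
  simpa using AddMonoidAlgebra.coeff_mul_single_add p 1 m n

/-- Replacing each variable by its multiple by `τ` scales the coefficient of a monomial of degree
`n` by `τ ^ n`. The map `θ` is only additive, to allow `laurentMap`, which is assembled weight by
weight. -/
lemma coeff_eval₂_C_mul_X {σ R L : Type*} [CommRing R] [CommRing L] (θ : R →+ L) (τ : L)
    {χ : R →+* MvPolynomial σ L} (hχ : ∀ a, χ a = MvPolynomial.C (θ a))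
    {v : σ → MvPolynomial σ L} (hv : ∀ i, v i = MvPolynomial.C τ * MvPolynomial.X i)
    (p : MvPolynomial σ R) (α : σ →₀ ℕ) :
    (MvPolynomial.eval₂ χ v p).coeff α = θ (p.coeff α) * τ ^ α.degree := by
  classical
  induction p using MvPolynomial.induction_on' with
  | monomial β a =>
    have h : (β.prod fun i n ↦ v i ^ n) = MvPolynomial.monomial β (τ ^ β.degree) := by
      simp only [hv, mul_pow, Finsupp.prod_mul, MvPolynomial.monomial_eq, ← map_pow]
      congr 1
      rw [Finsupp.prod, ← map_prod, Finset.prod_pow_eq_pow_sum]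
      rfl
    rw [MvPolynomial.eval₂_monomial, h, hχ, MvPolynomial.C_mul_monomial,
      MvPolynomial.coeff_monomial, MvPolynomial.coeff_monomial]
    split_ifs with hβ
    · rw [hβ]
    · rw [map_zero, zero_mul]
  | add p q hp hq =>
    rw [MvPolynomial.eval₂_add, MvPolynomial.coeff_add, hp, hq, MvPolynomial.coeff_add, map_add,
      add_mul]

/-- The action of `𝔾ₘ` on `C` as a co-action on `𝒜(U)`. -/
def laurentMap (U : X.S.left.affineOpens) : X.alg U →+ LaurentPolynomial (X.alg U) :=
  (DirectSum.toAddMonoid fun n : ℕ ↦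
    ((AddMonoidHom.mulLeft (LaurentPolynomial.T (n : ℤ))).comp
      (LaurentPolynomial.C (R := X.alg U)).toAddMonoidHom).comp (X.gr U n).subtype).comp
    (DirectSum.decomposeAddEquiv (X.gr U)).toAddMonoidHom

lemma laurentMap_of_mem {U : X.S.left.affineOpens} {n : ℕ} {f : X.alg U} (hf : f ∈ X.gr U n) :
    X.laurentMap U f = LaurentPolynomial.T (n : ℤ) * LaurentPolynomial.C f := by
  lift f to X.gr U n using hf
  simp [laurentMap]

lemma coeff_laurentMap (U : X.S.left.affineOpens) (f : X.alg U) (n : ℕ) :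
    (X.laurentMap U f).coeff (n : ℤ) = GradedRing.proj (X.gr U) n f := by
  classical
  induction f using DirectSum.Decomposition.inductionOn (X.gr U) with
  | zero => simp
  | add a b ha hb => simp [ha, hb]
  | homogeneous a =>
    rename_i m
    rw [X.laurentMap_of_mem a.2, LaurentPolynomial.T_mul, coeff_C_mul_T, GradedRing.proj_apply]
    by_cases h : m = n
    · subst h
      simp
    · rw [DirectSum.decompose_of_mem_ne _ a.2 h, if_neg (by exact_mod_cast h)]

/-- The co-action of `𝔾ₐ^r` on functions of weight `n`, in terms of the co-action of `𝔾ₘ`. -/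
lemma laurentMap_coeff_coaction {U : X.S.left.affineOpens} {n : ℕ} {f : X.alg U}
    (hf : f ∈ X.gr U n) (α : Fin r →₀ ℕ) :
    X.laurentMap U ((X.coaction U f).coeff α) * LaurentPolynomial.T ((w * α.degree : ℕ) : ℤ) =
      LaurentPolynomial.T (n : ℤ) * LaurentPolynomial.C ((X.coaction U f).coeff α) := by
  classical
  -- The relation `t.(u.x) = (t ^ w u).(t.x)` is evaluated on `f` at the universal point over
  -- `𝒜(U)[t, t⁻¹][u₁, …, u_r]`, and the coefficients of `u ^ α` are compared.
  let L := LaurentPolynomial (X.alg U)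
  let P := MvPolynomial (Fin r) L
  let ψ : X.alg U →+* P := MvPolynomial.C.comp LaurentPolynomial.C
  let x := X.affPoint U ψ
  have hx : ⊤ ≤ x.left ⁻¹ᵁ (X.π.left ⁻¹ᵁ U) := X.top_le_affPoint U ψ
  let τ : Lˣ := ⟨LaurentPolynomial.T 1, LaurentPolynomial.T (-1),
      by rw [← LaurentPolynomial.T_add]; simp, by rw [← LaurentPolynomial.T_add]; simp⟩
  let t : (Γ((X.affOver U ψ).left, ⊤))ˣ :=
    Units.map ((specFun (R := .of P)).comp MvPolynomial.C).toMonoidHom τ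
  let v : Fin r → Γ((X.affOver U ψ).left, ⊤) := fun i ↦ specFun (R := .of P) (MvPolynomial.X i)
  have htn : ∀ m : ℕ, (t : Γ((X.affOver U ψ).left, ⊤)) ^ m =
      specFun (R := .of P) (MvPolynomial.C (LaurentPolynomial.T (m : ℤ))) := by
    intro m
    change specFun (R := .of P) (MvPolynomial.C (LaurentPolynomial.T 1)) ^ m = _
    rw [← map_pow, ← map_pow, LaurentPolynomial.T_pow, mul_one]
  have hgm : ∀ a, ((X.gm.act t x).left.appLE _ ⊤ (X.top_le_gm hx t)).hom a =
      specFun (R := .of P) (MvPolynomial.C (X.laurentMap U a)) := by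
    intro a
    induction a using DirectSum.Decomposition.inductionOn (X.gr U) with
    | zero => simp
    | add a b ha hb => simp only [map_add, ha, hb]
    | homogeneous a =>
      rename_i m
      rw [X.gm_appLE x U hx t _ a.2, X.laurentMap_of_mem a.2, htn, X.affPoint_appLE]
      rw [← map_mul, map_mul MvPolynomial.C]
      rfl
  have h1 := X.semidirect t v x
  have h2 : ∀ (y : X.affOver U ψ ⟶ X.C) (_ : X.gm.act t (X.ga.act v x) = y)
      (hy : ⊤ ≤ y.left ⁻¹ᵁ (X.π.left ⁻¹ᵁ U)),
      (y.left.appLE _ ⊤ hy).hom f = (t : Γ((X.affOver U ψ).left, ⊤)) ^ n *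
        MvPolynomial.eval₂ (x.left.appLE _ ⊤ hx).hom v (X.coaction U f) := by
    rintro y rfl hy
    rw [X.gm_appLE _ U (X.top_le_ga hx v) t hy hf, X.ga_appLE x U hx v]
  have h3 := h2 _ h1 (X.top_le_ga (X.top_le_gm hx t) _)
  rw [X.ga_appLE _ U (X.top_le_gm hx t)] at h3
  let e : Γ((X.affOver U ψ).left, ⊤) →+* P := (Scheme.ΓSpecIso (.of P)).hom.hom
  have he : ∀ p : P, e (specFun (R := .of P) p) = p := fun p ↦
    congr($((Scheme.ΓSpecIso (.of P)).inv_hom_id).hom p)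
  have h4 := congr_arg (MvPolynomial.coeff α) (congr_arg e h3)
  rw [map_mul, htn n, he, MvPolynomial.coeff_C_mul, MvPolynomial.eval₂_comp_left,
    MvPolynomial.eval₂_comp_left,
    coeff_eval₂_C_mul_X (X.laurentMap U) (LaurentPolynomial.T (w : ℤ))
      (fun a ↦ (congr_arg e (hgm a)).trans (he _)) (fun i ↦ by simp [htn, he, v]),
    coeff_eval₂_C_mul_X (LaurentPolynomial.C (R := X.alg U)).toAddMonoidHom 1
      (fun a ↦ (congr_arg e (X.affPoint_appLE U ψ hx a)).trans (he _))
      (fun i ↦ by simp [he, v]), LaurentPolynomial.T_pow, one_pow, mul_one,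
    mul_comm _ (w : ℤ)] at h4
  exact_mod_cast h4

/-- Compare the coefficients of `t ^ (m + w |α|)` in `laurentMap_coeff_coaction`: the right-hand
side only contains `t ^ n`. -/
lemma proj_coeff_coaction {U : X.S.left.affineOpens} {n : ℕ} {f : X.alg U}
    (hf : f ∈ X.gr U n) (α : Fin r →₀ ℕ) (m : ℕ) (hm : m + w * α.degree ≠ n) :
    GradedRing.proj (X.gr U) m ((X.coaction U f).coeff α) = 0 := by
  have h := congr(($(X.laurentMap_coeff_coaction hf α)).coeff ((m : ℤ) + (w * α.degree : ℕ)))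
  rwa [coeff_mul_T, X.coeff_laurentMap, LaurentPolynomial.T_mul, coeff_C_mul_T,
    if_neg (by exact_mod_cast hm.symm)] at h

/-- The coefficient would have weight `n - w |α|`, and there are no negative weights. -/
lemma coeff_coaction_eq_zero {U : X.S.left.affineOpens} {n : ℕ} {f : X.alg U}
    (hf : f ∈ X.gr U n) (α : Fin r →₀ ℕ) (hn : n < w * α.degree) :
    (X.coaction U f).coeff α = 0 := by
  classical
  rw [← DirectSum.sum_support_decompose (X.gr U) ((X.coaction U f).coeff α)]
  exact Finset.sum_eq_zero fun m _ ↦ X.proj_coeff_coaction hf α m (by omega)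

lemma coeff_coaction_mem {U : X.S.left.affineOpens} {n m : ℕ} {f : X.alg U}
    (hf : f ∈ X.gr U n) (α : Fin r →₀ ℕ) (hn : m + w * α.degree = n) :
    (X.coaction U f).coeff α ∈ X.gr U m := by
  classical
  rw [← DirectSum.sum_support_decompose (X.gr U) ((X.coaction U f).coeff α)]
  refine sum_mem fun i _ ↦ ?_
  by_cases h : i = m
  · subst h; exact SetLike.coe_mem _
  · have := X.proj_coeff_coaction hf α i (by omega)
    rw [GradedRing.proj_apply] at this
    rw [this]
    exact zero_mem _

end Cone

/-! ### First order terms of polynomials -/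

lemma constantCoeff_pderiv {σ R : Type*} [CommRing R] (i : σ) (p : MvPolynomial σ R) :
    MvPolynomial.constantCoeff (MvPolynomial.pderiv i p) = p.coeff (Finsupp.single i 1) := by
  rw [MvPolynomial.constantCoeff_eq, MvPolynomial.coeff_pderiv]
  simp

lemma exists_eq_single_of_degree_eq_one {σ : Type*} {α : σ →₀ ℕ} (h : α.degree = 1) :
    ∃ i, α = Finsupp.single i 1 := by
  obtain ⟨i, hi⟩ : ∃ i, α i ≠ 0 := by
    by_contra! h0
    rw [show α = 0 from Finsupp.ext h0] at h
    simp at h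
  have hle : Finsupp.single i 1 ≤ α := by
    rw [Finsupp.single_le_iff]
    omega
  have h1 := congr_arg Finsupp.degree (add_tsub_cancel_of_le hle)
  rw [map_add, Finsupp.degree_single, h, add_eq_left, Finsupp.degree_eq_zero_iff] at h1
  exact ⟨i, by rw [← add_tsub_cancel_of_le hle, h1, add_zero]⟩

/-- As `ε² = 0`, only the terms of degree at most one survive at `u = ε ξ`. This links the
stabiliser, defined by points over `k[ε]`, to the vector fields. -/
lemma eval₂_inr {σ R k : Type*} [Fintype σ] [CommRing R] [Field k] (φ : R →+* k) (ξ : σ → k)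
    (p : MvPolynomial σ R) :
    MvPolynomial.eval₂ ((algebraMap k (DualNumber k)).comp φ)
      (fun i ↦ (TrivSqZeroExt.inr (ξ i) : DualNumber k)) p =
      TrivSqZeroExt.inl (φ (p.coeff 0)) +
        TrivSqZeroExt.inr (∑ i, ξ i * φ (p.coeff (Finsupp.single i 1))) := by
  classical
  induction p using MvPolynomial.induction_on with
  | C a =>
    have : ∀ i : σ, (0 : σ →₀ ℕ) ≠ Finsupp.single i 1 := fun i h ↦ by
      simpa using congr($h i)
    simp [MvPolynomial.coeff_C, this, TrivSqZeroExt.algebraMap_eq_inl]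
  | add p q hp hq =>
    rw [MvPolynomial.eval₂_add, hp, hq]
    simp only [MvPolynomial.coeff_add, map_add, mul_add, Finset.sum_add_distrib,
      TrivSqZeroExt.inl_add, TrivSqZeroExt.inr_add]
    abel
  | mul_X p j hp =>
    rw [MvPolynomial.eval₂_mul, hp, MvPolynomial.eval₂_X]
    have h0 : (p * MvPolynomial.X j).coeff 0 = 0 := by
      rw [MvPolynomial.coeff_mul_X']; simp
    have h1 : ∀ i, (p * MvPolynomial.X j).coeff (Finsupp.single i 1) =
        if i = j then p.coeff 0 else 0 := by
      intro i
      rw [MvPolynomial.coeff_mul_X']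
      by_cases hij : i = j
      · subst hij; simp
      · simp [hij, Ne.symm hij]
    simp only [h0, h1]
    ext <;> simp [apply_ite φ, mul_comm]

namespace Cone

variable {k : Type u} [Field k] {r w : ℕ} (X : Cone k r w)

/-! ### The vector fields and the centre -/

lemma vectorField_apply {U : X.S.left.affineOpens} (i : Fin r) (f : X.alg U) :
    X.vectorField U i f = (X.coaction U f).coeff (Finsupp.single i 1) :=
  constantCoeff_pderiv i _

lemma vectorField_of_mem_zero {U : X.S.left.affineOpens} (i : Fin r) {f : X.alg U}
    (hf : f ∈ X.gr U 0) : X.vectorField U i f = 0 := by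
  obtain ⟨a, rfl⟩ := X.mem_gr_zero.1 hf
  exact (X.vectorField U i).map_algebraMap a

lemma vectorField_mem {U : X.S.left.affineOpens} (i : Fin r) {n : ℕ} {f : X.alg U}
    (hf : f ∈ X.gr U (n + w)) : X.vectorField U i f ∈ X.gr U n := by
  rw [vectorField_apply]
  exact X.coeff_coaction_mem hf _ (by simp)

/-- The vector fields lower weights by `w`, so only the part of `f` of weight `w` contributes to the
derivative on the zero section. -/
lemma proj_zero_vectorField {U : X.S.left.affineOpens} (i : Fin r) (f : X.alg U) :
    GradedRing.proj (X.gr U) 0 (X.vectorField U i f) =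
      X.vectorField U i (GradedRing.proj (X.gr U) w f) := by
  classical
  induction f using DirectSum.Decomposition.inductionOn (X.gr U) with
  | zero => simp
  | add a b ha hb => simp only [map_add, ha, hb]
  | homogeneous a =>
    rename_i n
    by_cases h : n = w
    · subst h
      rw [proj_of_mem _ a.2, proj_of_mem]
      exact X.vectorField_mem i (by simp)
    · rw [GradedRing.proj_apply _ w, DirectSum.decompose_of_mem_ne _ a.2 h, map_zero,
        vectorField_apply]
      exact X.proj_coeff_coaction a.2 _ 0 (by simpa using Ne.symm h)

lemma mem_centreIdeal {U : X.S.left.affineOpens} {f : X.alg U} :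
    f ∈ X.centreIdeal U ↔ ∀ α, (X.coaction U f).coeff α ∈ X.singIdeal U := by
  rw [centreIdeal, RingHom.mem_ker, RingHom.comp_apply, MvPolynomial.ext_iff]
  simp only [MvPolynomial.coeff_map, MvPolynomial.coeff_zero, Ideal.Quotient.eq_zero_iff_mem]

lemma centreIdeal_le_singIdeal (U : X.S.left.affineOpens) : X.centreIdeal U ≤ X.singIdeal U := by
  intro f hf
  have := X.mem_centreIdeal.1 hf 0
  rwa [← MvPolynomial.constantCoeff_eq, constantCoeff_coaction] at this

/-- Functions of weight zero come from `S`, so they are invariant and their co-action is constant in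
`u`. -/
lemma mem_centreIdeal_of_mem_zero {U : X.S.left.affineOpens} {f : X.alg U} (hf : f ∈ X.gr U 0)
    (hI : f ∈ X.singIdeal U) : f ∈ X.centreIdeal U := by
  obtain ⟨a, rfl⟩ := X.mem_gr_zero.1 hf
  rw [centreIdeal, RingHom.mem_ker, RingHom.comp_apply, coaction_app, MvPolynomial.map_C,
    Ideal.Quotient.eq_zero_iff_mem.2 hI, map_zero]

lemma posIdeal_le_singIdeal (U : X.S.left.affineOpens) : X.posIdeal U ≤ X.singIdeal U :=
  le_sup_right

lemma proj_zero_mem_centreIdeal {U : X.S.left.affineOpens} {f : X.alg U}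
    (hf : f ∈ X.centreIdeal U) : GradedRing.proj (X.gr U) 0 f ∈ X.centreIdeal U := by
  refine X.mem_centreIdeal_of_mem_zero (proj_mem _ _ _) ?_
  rw [← sub_sub_cancel f (GradedRing.proj (X.gr U) 0 f)]
  exact sub_mem (X.centreIdeal_le_singIdeal U hf)
    (X.posIdeal_le_singIdeal U (X.sub_proj_zero_mem_posIdeal f))

/-- For weight reasons the co-action of `f` is `f + ∑ uᵢ ξᵢ.f`. Its constant term has weight `w >
0`, hence lies in `𝒜_{>0} ⊆ ℐ`, and its linear coefficients lie in `𝒥 ⊆ ℐ`. -/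
lemma mem_centreIdeal_of_vectorField_mem (hw : 0 < w) {U : X.S.left.affineOpens} {f : X.alg U}
    (hf : f ∈ X.gr U w) (h : ∀ i, X.vectorField U i f ∈ X.centreIdeal U) :
    f ∈ X.centreIdeal U := by
  rw [mem_centreIdeal]
  intro α
  rcases Nat.lt_or_ge 1 α.degree with hα | hα
  · rw [X.coeff_coaction_eq_zero hf α (by nlinarith)]
    exact zero_mem _
  rcases Nat.lt_or_ge 0 α.degree with hα' | hα'
  · obtain ⟨i, rfl⟩ : ∃ i, α = Finsupp.single i 1 :=
      exists_eq_single_of_degree_eq_one (by omega)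
    rw [← vectorField_apply]
    exact X.centreIdeal_le_singIdeal U (h i)
  · obtain rfl : α = 0 := (Finsupp.degree_eq_zero_iff α).1 (by omega)
    rw [← MvPolynomial.constantCoeff_eq, constantCoeff_coaction]
    exact X.posIdeal_le_singIdeal U (X.mem_posIdeal hw hf)

/-! ### The Fitting ideal in weight zero -/

lemma conormalMap_D {U : X.S.left.affineOpens} (f : X.alg U) :
    X.conormalMap U (KaehlerDifferential.D _ _ f) = fun i ↦ X.vectorField U i f := by
  funext i
  simp [conormalMap]

lemma det_mem_gr_zero {U : X.S.left.affineOpens} {m : ℕ} {h : Fin m → X.alg U}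
    (hh : ∀ i, h i ∈ X.gr U w) (s : Fin m → Fin r) :
    (Matrix.of fun i j ↦ X.vectorField U (s j) (h i)).det ∈ X.gr U 0 :=
  det_mem_zero _ fun i j ↦ X.vectorField_mem (s j) (by simpa using hh i)

lemma derivMinors_subset_fit (U : X.S.left.affineOpens) (d : ℕ) :
    derivMinors (X.gr U) (X.vectorField U) w (r - d) ⊆ X.fit U d := by
  rintro _ ⟨h, s, -, rfl⟩
  refine Ideal.subset_span ⟨fun i ↦ ⟨X.conormalMap U (KaehlerDifferential.D _ _ (h i)), ?_⟩, s, ?_⟩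
  · simp
  · simp [conormalMap_D]

/-- Modulo `𝒜_{>0}` every relation of `𝒬(π)` comes from one function of weight `w`: for `a df` take
the weight zero part of `a` times the weight `w` part of `f`. -/
lemma exists_vectorField_eq_proj_zero {U : X.S.left.affineOpens} (ω : Ω[X.alg U⁄Γ(X.S.left, U)]) :
    ∃ h ∈ X.gr U w, ∀ i, GradedRing.proj (X.gr U) 0 (X.conormalMap U ω i) =
      X.vectorField U i h := by
  have hω : ω ∈ Submodule.span (X.alg U) (Set.range (KaehlerDifferential.D Γ(X.S.left, U)
      (X.alg U))) := by
    rw [KaehlerDifferential.span_range_derivation]; trivial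
  induction hω using Submodule.span_induction with
  | mem _ h =>
    obtain ⟨f, rfl⟩ := h
    refine ⟨GradedRing.proj (X.gr U) w f, proj_mem _ _ _, fun i ↦ ?_⟩
    rw [conormalMap_D, proj_zero_vectorField]
  | zero => exact ⟨0, zero_mem _, fun i ↦ by simp⟩
  | add ω ω' _ _ h h' =>
    obtain ⟨h, hh, e⟩ := h
    obtain ⟨h', hh', e'⟩ := h'
    refine ⟨h + h', add_mem hh hh', fun i ↦ ?_⟩
    rw [map_add, Pi.add_apply, map_add, e, e', map_add]
  | smul a ω _ h =>
    obtain ⟨h, hh, e⟩ := h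
    refine ⟨GradedRing.proj (X.gr U) 0 a * h, ?_, fun i ↦ ?_⟩
    · simpa using SetLike.GradedMul.mul_mem (proj_mem (X.gr U) 0 a) hh
    · rw [map_smul, Pi.smul_apply, smul_eq_mul, proj_zero_mul, e, Derivation.leibniz,
        X.vectorField_of_mem_zero i (proj_mem (X.gr U) 0 a)]
      simp

/-- The projection to weight zero is a ring homomorphism. It kills `𝒜_{>0}` and sends each minor
generating the Fitting ideal to a minor of derivatives of functions of weight `w`; apply it to `𝒥 ⊆
ℐ`. -/
lemma proj_zero_mem_span_derivMinors {U : X.S.left.affineOpens} {f : X.alg U}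
    (hf : f ∈ X.centreIdeal U) : GradedRing.proj (X.gr U) 0 f ∈
      Ideal.span (derivMinors (X.gr U) (X.vectorField U) w (r - X.d)) := by
  let ρ : X.alg U →+* X.alg U := GradedRing.projZeroRingHom (X.gr U)
  have h : X.singIdeal U ≤
      (Ideal.span (derivMinors (X.gr U) (X.vectorField U) w (r - X.d))).comap ρ := by
    rw [singIdeal, sup_le_iff]
    constructor
    · rw [fit, fittingIdeal, Ideal.span_le]
      rintro _ ⟨v, s, rfl⟩
      have hv : ∀ i, ∃ ω, X.conormalMap U ω = (v i).1 := fun i ↦ by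
        simpa using (v i).2
      choose ω hω using hv
      choose h hh e using fun i ↦ X.exists_vectorField_eq_proj_zero (ω i)
      rw [SetLike.mem_coe, Ideal.mem_comap]
      refine Ideal.subset_span ⟨h, s, hh, ?_⟩
      rw [RingHom.map_det]
      congr 1
      ext i j
      simp only [RingHom.mapMatrix_apply, Matrix.map_apply, Matrix.of_apply, ← hω, ← e]
      rfl
    · intro f hf
      rw [Ideal.mem_comap, show ρ f = 0 from X.proj_zero_eq_zero_of_mem_posIdeal hf]
      exact zero_mem _
  exact h (X.centreIdeal_le_singIdeal U hf)

lemma derivMinors_subset_centreIdeal (U : X.S.left.affineOpens) :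
    derivMinors (X.gr U) (X.vectorField U) w (r - X.d) ⊆ X.centreIdeal U := by
  intro δ hδ
  refine X.mem_centreIdeal_of_mem_zero ?_
    (le_sup_left (a := X.fit U X.d) (X.derivMinors_subset_fit U X.d hδ))
  obtain ⟨h, s, hh, rfl⟩ := hδ
  exact X.det_mem_gr_zero hh s

end Cone

/-! ### Functions at rational points -/

section Points

variable {k : Type u} [Field k]

/-- The value of functions on `V` at a `k`-rational point of `V`. -/
def evalAt {X : SchOver k} (z : KPoint X) (V : X.left.Opens) (h : ⊤ ≤ z.left ⁻¹ᵁ V) :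
    Γ(X.left, V) →+* k :=
  (z.left.appLE V ⊤ h ≫ (Scheme.ΓSpecIso (.of k)).hom).hom

lemma specFun_evalAt {X : SchOver k} (z : KPoint X) (V : X.left.Opens) (h : ⊤ ≤ z.left ⁻¹ᵁ V)
    (f : Γ(X.left, V)) :
    specFun (R := .of k) (evalAt z V h f) = (z.left.appLE V ⊤ h).hom f :=
  congr($((Scheme.ΓSpecIso (.of k)).hom_inv_id).hom _)

lemma evalAt_eq_zero_iff {X : SchOver k} (z : KPoint X) (V : X.left.Opens) (h : ⊤ ≤ z.left ⁻¹ᵁ V)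
    (f : Γ(X.left, V)) : evalAt z V h f = 0 ↔ (z.left.appLE V ⊤ h).hom f = 0 := by
  rw [← specFun_evalAt, map_eq_zero_iff _ (Cone.specFun_injective (.of k))]

lemma evalAt_comp {X Y : SchOver k} (z : KPoint X) (p : X ⟶ Y) {V : X.left.Opens} {U : Y.left.Opens}
    (h : ⊤ ≤ z.left ⁻¹ᵁ V) (hp : V ≤ p.left ⁻¹ᵁ U) (h' : ⊤ ≤ (z ≫ p).left ⁻¹ᵁ U)
    (f : Γ(Y.left, U)) : evalAt (z ≫ p) U h' f = evalAt z V h ((p.left.appLE U V hp).hom f) :=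
  congr((Scheme.ΓSpecIso (.of k)).hom.hom $(appLE_comp_apply z.left p.left h hp h' f))

lemma top_le_of_pos_mem {X : SchOver k} {z : KPoint X} {V : X.left.Opens} (h : z.pos ∈ V) :
    ⊤ ≤ z.left ⁻¹ᵁ V := by
  intro p _
  obtain rfl : p = IsLocalRing.closedPoint k := Subsingleton.elim (α := PrimeSpectrum k) _ _
  exact h

lemma mem_basicOpen_iff_evalAt_ne_zero {X : SchOver k} (z : KPoint X) {V : X.left.Opens}
    (h : ⊤ ≤ z.left ⁻¹ᵁ V) (f : Γ(X.left, V)) :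
    z.pos ∈ X.left.basicOpen f ↔ evalAt z V h f ≠ 0 := by
  have h1 := Scheme.basicOpen_appLE z.left ⊤ V h f
  constructor
  · intro hz h0
    rw [evalAt_eq_zero_iff] at h0
    have h2 : IsLocalRing.closedPoint k ∈ (⊤ ⊓ z.left ⁻¹ᵁ X.left.basicOpen f) := ⟨trivial, hz⟩
    rw [← h1, h0, Scheme.basicOpen_zero] at h2
    exact h2
  · intro hne
    have h2 : IsUnit ((z.left.appLE V ⊤ h).hom f) := by
      rw [← specFun_evalAt]
      exact (isUnit_iff_ne_zero.2 hne).map _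
    rw [Scheme.basicOpen_of_isUnit _ h2] at h1
    exact (h1.le (Set.mem_univ (IsLocalRing.closedPoint k))).2

lemma top_le_toPt_comp {X : SchOver k} {z : KPoint X} {V : X.left.Opens} (h : ⊤ ≤ z.left ⁻¹ᵁ V)
    (T : SchOver k) : ⊤ ≤ (toPt T ≫ z).left ⁻¹ᵁ V := fun p _ ↦
  h (Set.mem_univ ((toPt T).left p))

lemma toPt_comp_appLE {X : SchOver k} (z : KPoint X) {V : X.left.Opens} (h : ⊤ ≤ z.left ⁻¹ᵁ V)
    {R : Type u} [CommRing R] [Algebra k R] (h' : ⊤ ≤ (toPt (specOver k R) ≫ z).left ⁻¹ᵁ V)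
    (f : Γ(X.left, V)) :
    ((toPt (specOver k R) ≫ z).left.appLE V ⊤ h').hom f =
      specFun (R := .of R) (algebraMap k R (evalAt z V h f)) := by
  refine (appLE_comp_apply (toPt (specOver k R)).left z.left (V := ⊤) le_rfl h h' f).trans ?_
  rw [← specFun_evalAt]
  refine congr($(appLE_top (toPt (specOver k R)).left le_rfl).hom _).trans ?_
  exact congr($(Scheme.ΓSpecIso_inv_naturality (CommRingCat.ofHom (algebraMap k R))).hom _).symm

end Points

namespace Cone

variable {k : Type u} [Field k] {r w : ℕ} (X : Cone k r w)

/-- The values at `z` of the derivatives of functions along the vector fields. -/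
def tangentVectors (z : KPoint X.C) (U : X.S.left.affineOpens)
    (h : ⊤ ≤ z.left ⁻¹ᵁ (X.π.left ⁻¹ᵁ U)) : Set (Fin r → k) :=
  Set.range fun f : X.alg U ↦ fun i ↦ evalAt z _ h (X.vectorField U i f)

/-- The point `(ε ξ).z` takes `f` to `f(z) + ε ∑ ξᵢ (ξᵢ.f)(z)`, and the functions on the affine open
`π⁻¹ U` separate points over `k[ε]`. -/
lemma lieStab_eq_orthogonal (z : KPoint X.C) (U : X.S.left.affineOpens)
    (h : ⊤ ≤ z.left ⁻¹ᵁ (X.π.left ⁻¹ᵁ U)) :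
    X.ga.lieStab z = orthogonal (X.tangentVectors z U h) := by
  ext ξ
  let T := specOver k (DualNumber k)
  let v : Fin r → Γ(T.left, ⊤) :=
    fun i ↦ specFun (R := .of (DualNumber k)) (TrivSqZeroExt.inr (ξ i))
  have hT := top_le_toPt_comp h T
  have key : ∀ f, ((X.ga.act v (toPt T ≫ z)).left.appLE _ ⊤ (X.top_le_ga hT v)).hom f =
      specFun (R := .of (DualNumber k)) (TrivSqZeroExt.inl (evalAt z _ h f) +
        TrivSqZeroExt.inr (∑ i, ξ i * evalAt z _ h (X.vectorField U i f))) := by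
    intro f
    rw [X.ga_appLE _ U hT]
    have h1 : ((toPt T ≫ z).left.appLE (X.π.left ⁻¹ᵁ U) ⊤ hT).hom =
        (specFun (R := .of (DualNumber k))).comp
          ((algebraMap k (DualNumber k)).comp (evalAt z _ h)) :=
      RingHom.ext fun f ↦ toPt_comp_appLE z h hT f
    rw [h1]
    refine (MvPolynomial.eval₂_comp_left (specFun (R := .of (DualNumber k)))
      ((algebraMap k (DualNumber k)).comp (evalAt z _ h))
      (fun i ↦ TrivSqZeroExt.inr (ξ i)) (X.coaction U f)).symm.trans ?_
    rw [eval₂_inr, ← MvPolynomial.constantCoeff_eq, constantCoeff_coaction]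
    simp only [vectorField_apply]
  have key' : ∀ f, ((toPt T ≫ z).left.appLE _ ⊤ hT).hom f =
      specFun (R := .of (DualNumber k)) (TrivSqZeroExt.inl (evalAt z _ h f)) :=
    fun f ↦ toPt_comp_appLE z h hT f
  change X.ga.act v (toPt T ≫ z) = toPt T ≫ z ↔ _
  rw [mem_orthogonal, tangentVectors, Set.forall_mem_range]
  constructor
  · intro hξ f
    have h2 : ∀ (y : T ⟶ X.C) (_ : y = toPt T ≫ z) (hy : ⊤ ≤ y.left ⁻¹ᵁ (X.π.left ⁻¹ᵁ U)),
        (y.left.appLE _ ⊤ hy).hom f = ((toPt T ≫ z).left.appLE _ ⊤ hT).hom f := by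
      rintro y rfl hy; rfl
    have h3 := h2 _ hξ (X.top_le_ga hT v)
    rw [key, key'] at h3
    have h4 := specFun_injective (.of (DualNumber k)) h3
    simpa using congr_arg TrivSqZeroExt.snd h4
  · intro hξ
    ext1
    refine hom_ext_of_appLE (X.isAffineOpen_preimage U) (X.top_le_ga hT v) hT fun f ↦ ?_
    rw [key, key', hξ f]
    simp

/-! ### The zero section -/

/-- At such a point `t ^ n f(z) = f(z)`, which forces `f(z) = 0` for `n > 0`. Being fixed involves
no open subset of `S`, so it transports the zero section between charts and along equivariant
morphisms. -/
lemma mem_zeroSection_of_fixed {z : KPoint X.C}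
    (hz : X.gm.act (unitT k) (toPt _ ≫ z) = toPt _ ≫ z) : z ∈ X.zeroSection := by
  intro U h f hf
  rw [← evalAt_eq_zero_iff]
  have hle : X.posIdeal U ≤ RingHom.ker (evalAt z _ h) := by
    rw [posIdeal, Ideal.span_le]
    rintro f ⟨n, hn, hf⟩
    have hT := top_le_toPt_comp h (specOver k (LaurentPolynomial k))
    have h2 : ∀ (y : specOver k (LaurentPolynomial k) ⟶ X.C) (_ : y = toPt _ ≫ z)
        (hy : ⊤ ≤ y.left ⁻¹ᵁ (X.π.left ⁻¹ᵁ U)),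
        (y.left.appLE _ ⊤ hy).hom f = ((toPt _ ≫ z).left.appLE _ ⊤ hT).hom f := by
      rintro y rfl hy; rfl
    have h3 := h2 _ hz (X.top_le_gm hT _)
    have h4 : ((unitT k : (Γ((specOver k (LaurentPolynomial k)).left, ⊤))ˣ) :
        Γ((specOver k (LaurentPolynomial k)).left, ⊤)) ^ n =
        specFun (R := .of (LaurentPolynomial k)) (LaurentPolynomial.T (n : ℤ)) := by
      change specFun (R := .of (LaurentPolynomial k)) (LaurentPolynomial.T 1) ^ n = _
      rw [← map_pow, LaurentPolynomial.T_pow, mul_one]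
    rw [X.gm_appLE _ U hT _ _ hf, toPt_comp_appLE z h hT, h4, ← map_mul] at h3
    have h5 := congr_arg (fun p : LaurentPolynomial k ↦ p.coeff 0)
      (specFun_injective (.of (LaurentPolynomial k)) h3)
    rw [← LaurentPolynomial.C_eq_algebraMap] at h5
    have h6 := coeff_C_mul_T (evalAt z _ h f) 0 0
    rw [LaurentPolynomial.T_zero, mul_one, if_pos rfl] at h6
    simp only [LaurentPolynomial.T_mul, coeff_C_mul_T, h6] at h5
    rw [if_neg (by exact_mod_cast hn.ne')] at h5
    exact h5.symm
  exact hle hf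

lemma fixed_of_posIdeal {z : KPoint X.C} (U : X.S.left.affineOpens)
    (h : ⊤ ≤ z.left ⁻¹ᵁ (X.π.left ⁻¹ᵁ U)) (hz : ∀ f ∈ X.posIdeal U, evalAt z _ h f = 0) :
    X.gm.act (unitT k) (toPt _ ≫ z) = toPt _ ≫ z := by
  classical
  have hT := top_le_toPt_comp h (specOver k (LaurentPolynomial k))
  ext1
  refine hom_ext_of_appLE (X.isAffineOpen_preimage U) (X.top_le_gm hT _) hT fun f ↦ ?_
  induction f using DirectSum.Decomposition.inductionOn (X.gr U) with
  | zero => simp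
  | add a b ha hb => simp only [map_add, ha, hb]
  | homogeneous a =>
    rename_i n
    rw [X.gm_appLE _ U hT _ _ a.2]
    rcases Nat.eq_zero_or_pos n with rfl | hn
    · simp
    · rw [toPt_comp_appLE z h hT, hz _ (X.mem_posIdeal hn a.2)]
      simp

lemma mem_zeroSection_of_posIdeal {z : KPoint X.C} (U : X.S.left.affineOpens)
    (h : ⊤ ≤ z.left ⁻¹ᵁ (X.π.left ⁻¹ᵁ U)) (hz : ∀ f ∈ X.posIdeal U, evalAt z _ h f = 0) :
    z ∈ X.zeroSection :=
  X.mem_zeroSection_of_fixed (X.fixed_of_posIdeal U h hz)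

lemma evalAt_posIdeal {z : KPoint X.C} (hz : z ∈ X.zeroSection) (U : X.S.left.affineOpens)
    (h : ⊤ ≤ z.left ⁻¹ᵁ (X.π.left ⁻¹ᵁ U)) {f : X.alg U} (hf : f ∈ X.posIdeal U) :
    evalAt z _ h f = 0 :=
  (evalAt_eq_zero_iff z _ h f).2 (hz U h f hf)

lemma evalAt_proj_zero {z : KPoint X.C} (hz : z ∈ X.zeroSection) (U : X.S.left.affineOpens)
    (h : ⊤ ≤ z.left ⁻¹ᵁ (X.π.left ⁻¹ᵁ U)) (f : X.alg U) :
    evalAt z _ h (GradedRing.proj (X.gr U) 0 f) = evalAt z _ h f := by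
  have := X.evalAt_posIdeal hz U h (X.sub_proj_zero_mem_posIdeal f)
  rw [map_sub, sub_eq_zero] at this
  exact this.symm

lemma exists_affineOpen (z : KPoint X.C) :
    ∃ U : X.S.left.affineOpens, ⊤ ≤ z.left ⁻¹ᵁ (X.π.left ⁻¹ᵁ U) := by
  obtain ⟨U, hU, hz, -⟩ := exists_isAffineOpen_mem_and_subset
    (x := X.π.left z.pos) (U := ⊤) trivial
  exact ⟨⟨U, hU⟩, top_le_of_pos_mem hz⟩

/-! ### Points of the zero section -/

/-- The homomorphism `𝒜(U) → 𝒜₀(U) = 𝒪_S(U)` of the zero section. -/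
def zeroSectionMap (U : X.S.left.affineOpens) : X.alg U →+* Γ(X.S.left, U) :=
  (RingEquiv.ofBijective (X.π.left.app U).hom.rangeRestrict
    ⟨fun _ _ h ↦ X.app_injective U (congr_arg Subtype.val h),
      (X.π.left.app U).hom.rangeRestrict_surjective⟩).symm.toRingHom.comp
    ((GradedRing.projZeroRingHom (X.gr U)).codRestrict (X.π.left.app U).hom.range fun f ↦
      X.mem_gr_zero.1 (proj_mem (X.gr U) 0 f))

lemma app_zeroSectionMap (U : X.S.left.affineOpens) (f : X.alg U) :
    (X.π.left.app U).hom (X.zeroSectionMap U f) = GradedRing.proj (X.gr U) 0 f := by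
  let e := RingEquiv.ofBijective (X.π.left.app U).hom.rangeRestrict
    ⟨fun _ _ h ↦ X.app_injective U (congr_arg Subtype.val h),
      (X.π.left.app U).hom.rangeRestrict_surjective⟩
  exact congr_arg Subtype.val (e.apply_symm_apply
    ((GradedRing.projZeroRingHom (X.gr U)).codRestrict (X.π.left.app U).hom.range (fun f ↦
      X.mem_gr_zero.1 (proj_mem (X.gr U) 0 f)) f))

lemma zeroSectionMap_app (U : X.S.left.affineOpens) (a : Γ(X.S.left, U)) :
    X.zeroSectionMap U ((X.π.left.app U).hom a) = a :=
  X.app_injective U (by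
    rw [app_zeroSectionMap, proj_of_mem _ (X.mem_gr_zero.2 ⟨a, rfl⟩)])

lemma evalAt_app {z : KPoint X.C} {U : X.S.left.affineOpens}
    (h : ⊤ ≤ z.left ⁻¹ᵁ (X.π.left ⁻¹ᵁ U)) (h' : ⊤ ≤ (z ≫ X.π).left ⁻¹ᵁ U)
    (a : Γ(X.S.left, U)) :
    evalAt z _ h ((X.π.left.app U).hom a) = evalAt (z ≫ X.π) U.1 h' a := by
  rw [evalAt_comp z X.π h le_rfl h', Scheme.Hom.app_eq_appLE]

/-- Compose `y` with the section `S → C` dual to the projection `𝒜 → 𝒜₀ = 𝒪_S`. -/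
lemma exists_zeroSection_lift (U : X.S.left.affineOpens) (y : KPoint X.S) (hy : ⊤ ≤ y.left ⁻¹ᵁ U) :
    ∃ z ∈ X.zeroSection, z ≫ X.π = y := by
  have hV := X.isAffineOpen_preimage U
  let ψ : X.alg U ⟶ .of k := CommRingCat.ofHom ((evalAt y U.1 hy).comp (X.zeroSectionMap U))
  let ζ : Spec (.of k) ⟶ X.C.left := Spec.map ψ ≫ hV.fromSpec
  have hζ : ⊤ ≤ ζ ⁻¹ᵁ (X.π.left ⁻¹ᵁ U) := top_le_specMap_fromSpec hV ψ
  have hζapp : ∀ f, (ζ.appLE _ ⊤ hζ).hom f = specFun (R := .of k) (ψ.hom f) := fun f ↦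
    congr($(specMap_fromSpec_appLE hV ψ hζ).hom f)
  have h1 : ζ ≫ X.π.left = y.left := by
    refine hom_ext_of_appLE U.2 hζ hy fun a ↦ ?_
    rw [appLE_comp_apply ζ X.π.left hζ le_rfl hζ, hζapp, Scheme.Hom.appLE_eq_app]
    simp only [ψ, CommRingCat.hom_ofHom, RingHom.comp_apply, zeroSectionMap_app]
    exact specFun_evalAt y U.1 hy a
  let z : KPoint X.C := Over.homMk ζ (by
    rw [← Over.w X.π, ← Category.assoc, h1]
    exact Over.w y)
  refine ⟨z, X.mem_zeroSection_of_posIdeal U hζ fun f hf ↦ ?_, ?_⟩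
  · refine (evalAt_eq_zero_iff z _ hζ f).2 ((hζapp f).trans ?_)
    have : X.zeroSectionMap U f = 0 := X.app_injective U (by
      rw [app_zeroSectionMap, X.proj_zero_eq_zero_of_mem_posIdeal hf, map_zero])
    simp [ψ, this]
  · ext1
    exact h1

/-- Non-empty open subsets of a scheme locally of finite type over `k` contain closed points, which
are rational as `k` is algebraically closed; these lift to the zero section. -/
lemma exists_zeroSection_mem [IsAlgClosed k] {W : X.S.left.Opens}
    (hW : (W : Set X.S.left).Nonempty) :
    ∃ z ∈ X.zeroSection, X.π.left z.pos ∈ W := by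
  have := X.isVariety_S.locallyOfFiniteType
  have : JacobsonSpace X.S.left := LocallyOfFiniteType.jacobsonSpace X.S.hom
  obtain ⟨y, hyW, hy⟩ := nonempty_inter_closedPoints hW W.2.isLocallyClosed
  let η : KPoint X.S := Over.homMk (pointOfClosedPoint X.S.hom y hy)
    (pointOfClosedPoint_comp X.S.hom y hy)
  have hη : η.pos = y := pointOfClosedPoint_apply X.S.hom y hy _
  obtain ⟨U, hU, hyU, -⟩ := exists_isAffineOpen_mem_and_subset (x := y) (U := ⊤) trivial
  obtain ⟨z, hz, hzη⟩ := X.exists_zeroSection_lift ⟨U, hU⟩ η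
    (top_le_of_pos_mem (by rw [hη]; exact hyU))
  refine ⟨z, hz, ?_⟩
  have : X.π.left z.pos = y := by
    rw [← hη, ← hzη]
    rfl
  rw [this]
  exact hyW

lemma zeroSection_nonempty [IsAlgClosed k] : X.zeroSection.Nonempty := by
  have := X.isVariety_S.isIntegral
  obtain ⟨z, hz, -⟩ := X.exists_zeroSection_mem (W := ⊤) Set.univ_nonempty
  exact ⟨z, hz⟩

/-! ### Dimensions of stabilisers -/

lemma dimStab_le (z : KPoint X.C) : X.dimStab z ≤ r := by
  simpa [dimStab] using Submodule.finrank_le (X.ga.lieStab z)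

lemma d_le_dimStab {z : KPoint X.C} (hz : z ∈ X.zeroSection) : X.d ≤ X.dimStab z :=
  Nat.sInf_le ⟨z, hz, rfl⟩

/-- The zero section is non-empty, so the infimum is attained and is not the default value `0`. -/
lemma exists_dimStab_eq_d [IsAlgClosed k] : ∃ z ∈ X.zeroSection, X.dimStab z = X.d :=
  Nat.sInf_mem (X.zeroSection_nonempty.image X.dimStab)

lemma d_le [IsAlgClosed k] : X.d ≤ r := by
  obtain ⟨z, -, hz⟩ := X.exists_dimStab_eq_d
  exact hz ▸ X.dimStab_le z

lemma dimStab_add_le {z : KPoint X.C} {U : X.S.left.affineOpens}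
    (h : ⊤ ≤ z.left ⁻¹ᵁ (X.π.left ⁻¹ᵁ U)) {n : ℕ} (c : Fin n → X.alg U) (s : Fin n → Fin r)
    (hc : (Matrix.of fun i j ↦ evalAt z _ h (X.vectorField U (s j) (c i))).det ≠ 0) :
    X.dimStab z + n ≤ r := by
  rw [dimStab, X.lieStab_eq_orthogonal z U h]
  exact finrank_orthogonal_add_le (fun i l ↦ evalAt z _ h (X.vectorField U l (c i)))
    (fun i ↦ ⟨c i, rfl⟩) s hc

lemma exists_derivMinors_evalAt_ne_zero {z : KPoint X.C} (hz : z ∈ X.zeroSection)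
    {U : X.S.left.affineOpens} (h : ⊤ ≤ z.left ⁻¹ᵁ (X.π.left ⁻¹ᵁ U)) {n : ℕ}
    (hn : X.dimStab z + n ≤ r) :
    ∃ δ ∈ derivMinors (X.gr U) (X.vectorField U) w n, evalAt z _ h δ ≠ 0 := by
  rw [dimStab, X.lieStab_eq_orthogonal z U h] at hn
  obtain ⟨v, hv, s, hdet⟩ := exists_minor_ne_zero hn
  choose c hc using hv
  refine ⟨_, ⟨fun i ↦ GradedRing.proj (X.gr U) w (c i), s, fun i ↦ proj_mem _ _ _, rfl⟩, ?_⟩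
  rw [RingHom.map_det]
  convert! hdet
  ext i j
  rw [RingHom.mapMatrix_apply, Matrix.map_apply, Matrix.of_apply, Matrix.of_apply, ← hc,
    ← proj_zero_vectorField, X.evalAt_proj_zero hz]

lemma dimStab_add_le_of_derivMinors {z : KPoint X.C} {U : X.S.left.affineOpens}
    (h : ⊤ ≤ z.left ⁻¹ᵁ (X.π.left ⁻¹ᵁ U)) {n : ℕ} {δ : X.alg U}
    (hδ : δ ∈ derivMinors (X.gr U) (X.vectorField U) w n) (hne : evalAt z _ h δ ≠ 0) :
    X.dimStab z + n ≤ r := by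
  obtain ⟨c, s, -, rfl⟩ := hδ
  refine X.dimStab_add_le h c s ?_
  rwa [RingHom.map_det] at hne

lemma mem_gr_zero_of_mem_derivMinors {U : X.S.left.affineOpens} {n : ℕ} {δ : X.alg U}
    (hδ : δ ∈ derivMinors (X.gr U) (X.vectorField U) w n) : δ ∈ X.gr U 0 := by
  obtain ⟨h, s, hh, rfl⟩ := hδ
  exact X.det_mem_gr_zero hh s

lemma mem_basicOpen_iff {z : KPoint X.C} {U : X.S.left.affineOpens}
    (h : ⊤ ≤ z.left ⁻¹ᵁ (X.π.left ⁻¹ᵁ U)) (a : Γ(X.S.left, U)) :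
    X.π.left z.pos ∈ X.S.left.basicOpen a ↔ evalAt z _ h ((X.π.left.app U).hom a) ≠ 0 := by
  rw [X.evalAt_app h h]
  exact mem_basicOpen_iff_evalAt_ne_zero (z ≫ X.π) h a

/-- The dimension of the stabilisers of points of the zero section is upper semi-continuous. -/
lemma exists_dimStab_add_le {z : KPoint X.C} (hz : z ∈ X.zeroSection)
    {U : X.S.left.affineOpens} (h : ⊤ ≤ z.left ⁻¹ᵁ (X.π.left ⁻¹ᵁ U)) {n : ℕ}
    (hn : X.dimStab z + n ≤ r) :
    ∃ a : Γ(X.S.left, U), X.π.left z.pos ∈ X.S.left.basicOpen a ∧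
      ∀ z₁ : KPoint X.C, X.π.left z₁.pos ∈ X.S.left.basicOpen a → X.dimStab z₁ + n ≤ r := by
  obtain ⟨δ, hδ, hne⟩ := X.exists_derivMinors_evalAt_ne_zero hz h hn
  -- A minor has weight `0`, so it is a function on `S`; its non-vanishing is an open condition
  -- there.
  obtain ⟨a, rfl⟩ := X.mem_gr_zero.1 (X.mem_gr_zero_of_mem_derivMinors hδ)
  refine ⟨a, (X.mem_basicOpen_iff h a).2 hne, fun z₁ hz₁ ↦ ?_⟩
  have h₁ : ⊤ ≤ z₁.left ⁻¹ᵁ (X.π.left ⁻¹ᵁ U) :=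
    top_le_of_pos_mem (X.S.left.basicOpen_le a hz₁)
  exact X.dimStab_add_le_of_derivMinors h₁ hδ ((X.mem_basicOpen_iff h₁ a).1 hz₁)

/-- The minimum is attained at some point, hence bounds the dimension over an open subset of `S` by
semi-continuity, and this subset meets `U` because `S` is irreducible. -/
lemma exists_derivMinors_ne_zero [IsAlgClosed k] (U : X.S.left.affineOpens)
    (hU : (U.1 : Set X.S.left).Nonempty) :
    ∃ δ ∈ derivMinors (X.gr U) (X.vectorField U) w (r - X.d), δ ≠ 0 := by
  have := X.isVariety_S.isIntegral
  have hd := X.d_le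
  obtain ⟨z₀, hz₀, hd₀⟩ := X.exists_dimStab_eq_d
  obtain ⟨U₀, h₀⟩ := X.exists_affineOpen z₀
  obtain ⟨a, ha, hle⟩ := X.exists_dimStab_add_le hz₀ h₀ (n := r - X.d) (by omega)
  obtain ⟨z, hz, hza, hzU⟩ := X.exists_zeroSection_mem (W := X.S.left.basicOpen a ⊓ U.1)
    (nonempty_preirreducible_inter (X.S.left.basicOpen a).2 U.1.2 ⟨_, ha⟩ hU)
  have h : ⊤ ≤ z.left ⁻¹ᵁ (X.π.left ⁻¹ᵁ U) := top_le_of_pos_mem hzU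
  obtain ⟨δ, hδ, hne⟩ := X.exists_derivMinors_evalAt_ne_zero hz h (hle z hza)
  exact ⟨δ, hδ, fun h0 ↦ hne (by rw [h0, map_zero])⟩

end Cone

/-! ### Principal ideals in local domains -/

/-- Nakayama's lemma: otherwise each element of `s` is `g c` with `c` a non-unit, and `g` lies in
the maximal ideal times `g`. -/
lemma exists_dvd_of_span_eq_span_singleton {R : Type*} [CommRing R] [IsDomain R] [IsLocalRing R]
    {s : Set R} {g : R} (hg : g ≠ 0) (h : Ideal.span s = Ideal.span {g}) :
    ∃ f ∈ s, f ≠ 0 ∧ ∀ a ∈ s, f ∣ a := by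
  by_contra! hcon
  have hdvd : ∀ a ∈ s, g ∣ a := fun a ha ↦
    Ideal.mem_span_singleton.1 (h ▸ Ideal.subset_span ha)
  have hle : Ideal.span s ≤ IsLocalRing.maximalIdeal R * Ideal.span {g} := by
    rw [Ideal.span_le]
    intro a ha
    obtain ⟨c, rfl⟩ := hdvd a ha
    by_cases hc : IsUnit c
    · obtain ⟨a', ha', hna'⟩ := hcon (g * c) ha (mul_ne_zero hg hc.ne_zero)
      exact absurd (hc.mul_right_dvd.2 (hdvd a' ha')) hna'
    · rw [SetLike.mem_coe, mul_comm g c]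
      exact Ideal.mul_mem_mul ((IsLocalRing.mem_maximalIdeal c).2 hc)
        (Ideal.mem_span_singleton_self g)
  have hg' : g ∈ IsLocalRing.maximalIdeal R * Ideal.span {g} :=
    hle (h ▸ Ideal.mem_span_singleton_self g)
  rw [Ideal.mem_mul_span_singleton] at hg'
  obtain ⟨m, hm, he⟩ := hg'
  have : m = 1 := mul_right_cancel₀ hg (by rw [he, one_mul])
  exact (IsLocalRing.mem_maximalIdeal m).1 hm (this ▸ isUnit_one)

namespace Cone

variable {k : Type u} [Field k] {r w : ℕ} (X : Cone k r w)

/-! ### Blowing up -/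

variable {X} {J : ∀ U : X.S.left.affineOpens, Ideal (X.alg U)}

/-- Away from the centre the inverse image is the unit ideal, generated by `1`. -/
lemma inverseImageInvertible_of_le {Y : Scheme.{u}} {f : Y ⟶ X.C.left} {U : X.S.left.affineOpens}
    {a : X.alg U} (ha : a ∈ J U) (hf : ⊤ ≤ f ⁻¹ᵁ X.C.left.basicOpen a) :
    X.InverseImageInvertible J f := by
  intro y
  obtain ⟨V, hV, hyV, -⟩ := exists_isAffineOpen_mem_and_subset (x := y) (U := ⊤) trivial
  have hVa : V ≤ f ⁻¹ᵁ X.C.left.basicOpen a := le_top.trans hf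
  refine ⟨U, ⟨V, hV⟩, hVa.trans fun x hx ↦ X.C.left.basicOpen_le a hx, hyV, 1, one_mem _, ?_⟩
  rw [Ideal.span_singleton_one]
  refine Ideal.eq_top_of_isUnit_mem _ (Ideal.mem_map_of_mem _ ha) ?_
  refine RingedSpace.isUnit_of_isUnit_germ Y.toRingedSpace V _ fun x hx ↦ ?_
  refine (Scheme.mem_basicOpen _ _ x hx).1 ?_
  have h := Scheme.basicOpen_appLE f V (X.π.left ⁻¹ᵁ U)
    (hVa.trans fun x hx ↦ X.C.left.basicOpen_le a hx) a
  exact h.ge ⟨hx, hVa hx⟩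

/-- Uniqueness in the universal property: away from the centre the blowing up is a monomorphism. -/
lemma IsBlowup.hom_ext {B Y : Scheme.{u}} {b : B ⟶ X.C.left} (hb : X.IsBlowup J b)
    {U : X.S.left.affineOpens} {a : X.alg U} (ha : a ∈ J U) {g₁ g₂ : Y ⟶ B}
    (h : g₁ ≫ b = g₂ ≫ b) (hg : ⊤ ≤ (g₁ ≫ b) ⁻¹ᵁ X.C.left.basicOpen a) : g₁ = g₂ :=
  (hb.2 Y (g₁ ≫ b) (inverseImageInvertible_of_le ha hg)).unique rfl h.symm

/-! ### Germs of the inverse image ideal, and dominance of the blowing up -/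

/-- The germ at `y` of the inverse image of a function. -/
def pullGerm {Y C : Scheme.{u}} (p : Y ⟶ C) (y : Y) {V : C.Opens} (hy : p y ∈ V) :
    Γ(C, V) →+* Y.presheaf.stalk y :=
  (p.app V ≫ Y.presheaf.germ (p ⁻¹ᵁ V) y hy).hom

lemma germ_appLE {Y C : Scheme.{u}} (p : Y ⟶ C) {y : Y} {V : C.Opens} {W : Y.Opens}
    (h : W ≤ p ⁻¹ᵁ V) (hy : y ∈ W) (f : Γ(C, V)) :
    (Y.presheaf.germ W y hy).hom ((p.appLE V W h).hom f) = pullGerm p y (h hy) f := by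
  have : p.appLE V W h ≫ Y.presheaf.germ W y hy = p.app V ≫ Y.presheaf.germ _ y (h hy) := by
    rw [Scheme.Hom.appLE, Category.assoc, TopCat.Presheaf.germ_res]
  exact congr($(this).hom f)

lemma pullGerm_ne_zero_of_mem_nonZeroDivisors {Y B : Scheme.{u}} (j : Y ⟶ B) [IsOpenImmersion j]
    (y : Y) {V : B.Opens} (hV : IsAffineOpen V) (hy : j y ∈ V) {g : Γ(B, V)}
    (hg : g ∈ nonZeroDivisors Γ(B, V)) : pullGerm j y hy g ≠ 0 := by
  intro h0
  have h1 : (j.stalkMap y).hom ((B.presheaf.germ V (j y) hy).hom g) = 0 :=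
    congr($(Scheme.Hom.germ_stalkMap j V y hy).hom g).trans h0
  have h2 : (B.presheaf.germ V (j y) hy).hom g = 0 :=
    (map_eq_zero_iff _ (asIso (j.stalkMap y)).commRingCatIsoToRingEquiv.injective).1 h1
  let := B.presheaf.algebra_section_stalk ⟨j y, hy⟩
  have := hV.isLocalization_stalk ⟨j y, hy⟩
  obtain ⟨s, hs⟩ := (IsLocalization.map_eq_zero_iff (hV.primeIdealOf ⟨j y, hy⟩).asIdeal.primeCompl
    (B.presheaf.stalk (j y)) g).1 h2
  have hs0 : (s : Γ(B, V)) = 0 := (mem_nonZeroDivisors_iff.1 hg).2 _ hs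
  exact s.2 (hs0 ▸ zero_mem _)

/-- The stalk is a local domain, so the generator of the inverse image ideal can be taken among the
pullbacks of elements of `J` themselves. This stands in for the affine charts of the blowing up. -/
lemma IsBlowup.exists_pullGerm {B Y : Scheme.{u}} {b : B ⟶ X.C.left} (hb : X.IsBlowup J b)
    (j : Y ⟶ B) [IsOpenImmersion j] [IsIntegral Y] (y : Y) :
    ∃ (U : X.S.left.affineOpens) (hy : (j ≫ b) y ∈ X.π.left ⁻¹ᵁ U.1),
      ∃ f ∈ J U, pullGerm (j ≫ b) y hy f ≠ 0 ∧
        ∀ a ∈ J U, pullGerm (j ≫ b) y hy f ∣ pullGerm (j ≫ b) y hy a := by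
  obtain ⟨U, V, h, hyV, g, hg, hJ⟩ := hb.1 (j y)
  refine ⟨U, h hyV, ?_⟩
  have h1 : ∀ f : X.alg U, pullGerm (j ≫ b) y (h hyV) f =
      pullGerm j y hyV ((b.appLE _ V h).hom f) := by
    intro f
    rw [← germ_appLE (j ≫ b) (W := j ⁻¹ᵁ V) (fun x hx ↦ h hx) hyV f,
      ← Scheme.Hom.appLE_comp_appLE j b _ V _ h le_rfl, Scheme.Hom.appLE_eq_app]
    rfl
  have h2 : Ideal.span (pullGerm (j ≫ b) y (h hyV) '' (J U : Set (X.alg U))) =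
      Ideal.span {pullGerm j y hyV g} := by
    have h3 := congr_arg (Ideal.map (pullGerm j y hyV)) hJ
    rw [Ideal.map_span, Set.image_singleton, Ideal.map_map] at h3
    rw [← h3]
    change _ = Ideal.span _
    congr 1
    exact Set.image_congr fun f _ ↦ h1 f
  obtain ⟨_, ⟨f, hf, rfl⟩, hne, hdvd⟩ := exists_dvd_of_span_eq_span_singleton
    (pullGerm_ne_zero_of_mem_nonZeroDivisors j y V.2 hyV hg) h2
  exact ⟨f, hf, hne, fun a ha ↦ hdvd _ ⟨a, ha, rfl⟩⟩

/-- The restriction of the blowing up to a non-empty open subset is dominant. -/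
lemma IsBlowup.exists_mem_of_nonempty {B Y : Scheme.{u}} {b : B ⟶ X.C.left} (hb : X.IsBlowup J b)
    (j : Y ⟶ B) [IsOpenImmersion j] [IsIntegral Y] {N : Y.Opens} (hN : (N : Set Y).Nonempty)
    {W : X.C.left.Opens} (hW : (W : Set X.C.left).Nonempty) : ∃ x ∈ N, (j ≫ b) x ∈ W := by
  have := X.isVariety_C.isIntegral
  obtain ⟨y, hyN⟩ := hN
  obtain ⟨U, hy, f, hf, hne, -⟩ := hb.exists_pullGerm j y
  let E := X.C.left.basicOpen f
  have hι : ⊤ ≤ E.ι ⁻¹ᵁ E := by simp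
  -- As `f ∈ J U` is invertible on `E`, the blowing up has a section `g` over `E`.
  obtain ⟨g, hg, -⟩ := hb.2 E E.ι (inverseImageInvertible_of_le hf hι)
  let D : Y.Opens := (j ≫ b) ⁻¹ᵁ E
  have hD : (D : Set Y).Nonempty := by
    by_contra hemp
    rw [Set.not_nonempty_iff_eq_empty] at hemp
    have h1 : Y.basicOpen (((j ≫ b).app _).hom f) = ⊥ := by
      rw [← Scheme.preimage_basicOpen]
      exact Opens.ext hemp
    rw [basicOpen_eq_bot_iff] at h1
    exact hne (by
      change (Y.presheaf.germ _ y _).hom (((j ≫ b).app _).hom f) = 0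
      rw [h1, map_zero])
  let l : (D : Scheme.{u}) ⟶ E := (j ≫ b).resLE E D le_rfl
  have hl : l ≫ g = D.ι ≫ j := by
    refine hb.hom_ext hf ?_ ?_
    · rw [Category.assoc, hg, Category.assoc]
      exact Scheme.Hom.resLE_comp_ι _ _
    · intro x _
      rw [Category.assoc, hg]
      exact (l x).2
  obtain ⟨x, hxN, hxD⟩ := nonempty_preirreducible_inter N.2 D.2 ⟨y, hyN⟩ hD
  -- On `D` the open immersion `j` is `j ≫ b` followed by `g`. Hence `g` pulls `j (N ∩ D)` back to a
  -- non-empty open subset of `C`, all of whose points are images of points of `N`.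
  let O : Opens (E : Scheme.{u}) := g ⁻¹ᵁ (j ''ᵁ (N ⊓ D))
  let xD : (D : Scheme.{u}) := ⟨x, hxD⟩
  have hgl : g (l xD) = j x := by
    rw [← Scheme.Hom.comp_apply, hl]
    rfl
  have hO : (E.ι ''ᵁ O : Set X.C.left).Nonempty :=
    ⟨_, l xD, ⟨x, ⟨hxN, hxD⟩, hgl.symm⟩, rfl⟩
  obtain ⟨_, ⟨o, ⟨x', hx', hx'o⟩, rfl⟩, hoW⟩ :=
    nonempty_preirreducible_inter (E.ι ''ᵁ O).2 W.2 hO hW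
  refine ⟨x', hx'.1, ?_⟩
  have h2 : (j ≫ b) x' = E.ι o := by
    rw [← hg, Scheme.Hom.comp_apply, Scheme.Hom.comp_apply]
    exact congr_arg b hx'o
  rw [h2]
  exact hoW

end Cone

namespace Cone

variable {k : Type u} [Field k] {r w : ℕ} {X X' : Cone k r w}

/-! ### Equivariant morphisms of cones -/

section Equivariant

variable {p : X'.C ⟶ X.C} {U : X.S.left.affineOpens} {U' : X'.S.left.affineOpens}

lemma appLE_mem_gr
    (hgm : ∀ {T : SchOver k} (t : (Γ(T.left, ⊤))ˣ) (x : T ⟶ X'.C),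
      X'.gm.act t x ≫ p = X.gm.act t (x ≫ p))
    (hU : X'.π.left ⁻¹ᵁ U'.1 ≤ p.left ⁻¹ᵁ (X.π.left ⁻¹ᵁ U.1)) {n : ℕ} {f : X.alg U}
    (hf : f ∈ X.gr U n) : (p.left.appLE _ _ hU).hom f ∈ X'.gr U' n := by
  intro T t x h h'
  have hp : ∀ (x : T ⟶ X'.C), ⊤ ≤ x.left ⁻¹ᵁ (X'.π.left ⁻¹ᵁ U') →
      ⊤ ≤ (x ≫ p).left ⁻¹ᵁ (X.π.left ⁻¹ᵁ U) := fun x hx q hq ↦ hU (hx hq)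
  have h1 : ∀ (y : T ⟶ X.C) (_ : X'.gm.act t x ≫ p = y) (hy : ⊤ ≤ y.left ⁻¹ᵁ (X.π.left ⁻¹ᵁ U)),
      (y.left.appLE _ ⊤ hy).hom f =
        ((X'.gm.act t x).left.appLE _ ⊤ h').hom ((p.left.appLE _ _ hU).hom f) := by
    rintro y rfl hy
    exact appLE_comp_apply _ p.left h' hU hy f
  rw [← h1 _ (hgm t x) (X.top_le_gm (hp x h) t), X.gm_appLE _ U (hp x h) t _ hf]
  congr 1
  exact appLE_comp_apply x.left p.left h hU (hp x h) f

lemma comp_mem_zeroSection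
    (hgm : ∀ {T : SchOver k} (t : (Γ(T.left, ⊤))ˣ) (x : T ⟶ X'.C),
      X'.gm.act t x ≫ p = X.gm.act t (x ≫ p)) {z : KPoint X'.C} (hz : z ∈ X'.zeroSection) :
    z ≫ p ∈ X.zeroSection := by
  obtain ⟨U', h⟩ := X'.exists_affineOpen z
  have h1 := X'.fixed_of_posIdeal U' h fun f hf ↦ X'.evalAt_posIdeal hz U' h hf
  apply X.mem_zeroSection_of_fixed
  rw [← Category.assoc, ← hgm, h1]

lemma coaction_appLE
    (hga : ∀ {T : SchOver k} (u : Fin r → Γ(T.left, ⊤)) (x : T ⟶ X'.C),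
      X'.ga.act u x ≫ p = X.ga.act u (x ≫ p))
    (hU : X'.π.left ⁻¹ᵁ U'.1 ≤ p.left ⁻¹ᵁ (X.π.left ⁻¹ᵁ U.1)) (f : X.alg U) :
    X'.coaction U' ((p.left.appLE _ _ hU).hom f) =
      MvPolynomial.map (p.left.appLE _ _ hU).hom (X.coaction U f) := by
  let P := MvPolynomial (Fin r) (X'.alg U')
  let ψ : X'.alg U' →+* P := MvPolynomial.C
  let x := X'.affPoint U' ψ
  have hx : ⊤ ≤ x.left ⁻¹ᵁ (X'.π.left ⁻¹ᵁ U') := X'.top_le_affPoint U' ψ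
  have hxp : ⊤ ≤ (x ≫ p).left ⁻¹ᵁ (X.π.left ⁻¹ᵁ U) := fun q hq ↦ hU (hx hq)
  let v : Fin r → Γ((X'.affOver U' ψ).left, ⊤) := fun i ↦ specFun (R := .of P) (MvPolynomial.X i)
  have h1 : ∀ (y : X'.affOver U' ψ ⟶ X.C) (_ : X'.ga.act v x ≫ p = y)
      (hy : ⊤ ≤ y.left ⁻¹ᵁ (X.π.left ⁻¹ᵁ U)), (y.left.appLE _ ⊤ hy).hom f =
        ((X'.ga.act v x).left.appLE _ ⊤ (X'.top_le_ga hx v)).hom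
          ((p.left.appLE _ _ hU).hom f) := by
    rintro y rfl hy
    exact appLE_comp_apply _ p.left _ hU hy f
  have h2 := h1 _ (hga v x) (X.top_le_ga hxp v)
  rw [X.ga_appLE _ U hxp, X'.ga_appLE _ U' hx] at h2
  have h3 : (x.left.appLE _ ⊤ hx).hom = (specFun (R := .of P)).comp ψ :=
    RingHom.ext fun g ↦ X'.affPoint_appLE U' ψ hx g
  have h4 : ((x ≫ p).left.appLE _ ⊤ hxp).hom =
      (specFun (R := .of P)).comp (ψ.comp (p.left.appLE _ _ hU).hom) := by
    ext g
    refine (appLE_comp_apply x.left p.left hx hU hxp g).trans ?_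
    rw [h3]
    rfl
  rw [h3, h4] at h2
  have h5 : ∀ {R : Type u} [CommRing R] (χ : R →+* P) (q : MvPolynomial (Fin r) R),
      MvPolynomial.eval₂ ((specFun (R := .of P)).comp χ) v q =
        specFun (R := .of P) (MvPolynomial.eval₂ χ MvPolynomial.X q) := fun χ q ↦
    (MvPolynomial.eval₂_comp_left (specFun (R := .of P)) χ MvPolynomial.X q).symm
  rw [h5, h5] at h2
  have h6 := specFun_injective (.of P) h2
  exact (MvPolynomial.eval₂_eta _).symm.trans (h6.symm.trans
    ((MvPolynomial.eval₂_map _ _ _ _).symm.trans (MvPolynomial.eval₂_eta _)))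

lemma appLE_vectorField
    (hga : ∀ {T : SchOver k} (u : Fin r → Γ(T.left, ⊤)) (x : T ⟶ X'.C),
      X'.ga.act u x ≫ p = X.ga.act u (x ≫ p))
    (hU : X'.π.left ⁻¹ᵁ U'.1 ≤ p.left ⁻¹ᵁ (X.π.left ⁻¹ᵁ U.1)) (i : Fin r) (f : X.alg U) :
    (p.left.appLE _ _ hU).hom (X.vectorField U i f) =
      X'.vectorField U' i ((p.left.appLE _ _ hU).hom f) := by
  rw [vectorField_apply, vectorField_apply, coaction_appLE hga hU, MvPolynomial.coeff_map]

end Equivariant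

/-! ### The modification -/

/-- On the locus where the centre is empty, the stabilisers of points of a blowing up are at least
as large as those of their images. -/
lemma dimStab_comp_le {J : ∀ U : X.S.left.affineOpens, Ideal (X.alg U)} {B : SchOver k}
    {b : B ⟶ X.C} {j : X'.C ⟶ B} (hb : X.IsBlowup J b.left) (hj : IsOpenImmersion j.left)
    (hga : ∀ {T : SchOver k} (u : Fin r → Γ(T.left, ⊤)) (x : T ⟶ X'.C),
      X'.ga.act u x ≫ j ≫ b = X.ga.act u (x ≫ j ≫ b))
    {U : X.S.left.affineOpens} {a : X.alg U} (ha : a ∈ J U) {z : KPoint X'.C}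
    (hz : KPoint.pos (X := X.C) (z ≫ j ≫ b) ∈ X.C.left.basicOpen a) :
    X.dimStab (z ≫ j ≫ b) ≤ X'.dimStab z := by
  refine Submodule.finrank_mono fun ξ hξ ↦ ?_
  let T := specOver k (DualNumber k)
  let v : Fin r → Γ(T.left, ⊤) :=
    fun i ↦ specFun (R := .of (DualNumber k)) (TrivSqZeroExt.inr (ξ i))
  change X'.ga.act v (toPt T ≫ z) = toPt T ≫ z
  have h1 : X'.ga.act v (toPt T ≫ z) ≫ j ≫ b = toPt T ≫ z ≫ j ≫ b := by
    rw [hga, Category.assoc]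
    exact hξ
  have h2 : X'.ga.act v (toPt T ≫ z) ≫ j = (toPt T ≫ z) ≫ j := by
    ext1
    symm
    refine hb.hom_ext ha ?_ ?_
    · have := congr($(h1).left)
      simp only [Over.comp_left, Category.assoc] at this ⊢
      exact this.symm
    · have h3 : ((toPt T ≫ z) ≫ j).left ≫ b.left = (toPt T ≫ z ≫ j ≫ b).left := by
        simp only [Over.comp_left, Category.assoc]
      rw [h3]
      exact top_le_toPt_comp (X := X.C) (z := z ≫ j ≫ b) (top_le_of_pos_mem hz) T
  ext1
  have h3 := congr($(h2).left)
  rw [Over.comp_left, Over.comp_left] at h3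
  exact (cancel_mono j.left).1 h3

lemma appLE_ne_zero {J : ∀ U : X.S.left.affineOpens, Ideal (X.alg U)} {B : SchOver k}
    {b : B ⟶ X.C} {j : X'.C ⟶ B} (hb : X.IsBlowup J b.left) (hj : IsOpenImmersion j.left)
    {U : X.S.left.affineOpens} {U' : X'.S.left.affineOpens}
    (hU : X'.π.left ⁻¹ᵁ U'.1 ≤ (j ≫ b).left ⁻¹ᵁ (X.π.left ⁻¹ᵁ U.1))
    (hU' : ((X'.π.left ⁻¹ᵁ U'.1 : X'.C.left.Opens) : Set X'.C.left).Nonempty) {a : X.alg U}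
    (ha : a ≠ 0) : ((j ≫ b).left.appLE _ _ hU).hom a ≠ 0 := by
  have := X.isVariety_C.isIntegral
  have := X'.isVariety_C.isIntegral
  intro h0
  have hne : (X.C.left.basicOpen a : Set X.C.left).Nonempty := by
    by_contra hemp
    rw [Set.not_nonempty_iff_eq_empty] at hemp
    exact ha ((basicOpen_eq_bot_iff a).1 (Opens.ext hemp))
  obtain ⟨x, hx, hxa⟩ := hb.exists_mem_of_nonempty j.left hU' hne
  have h1 := Scheme.basicOpen_appLE (j ≫ b).left _ _ hU a
  rw [h0, Scheme.basicOpen_zero] at h1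
  exact h1.ge ⟨hx, hxa⟩

/-- The stalk at `z` is a localisation of `𝒜'(U')`: a denominator is a unit in it, hence does not
vanish at `z`, and germs are injective by integrality. -/
lemma generatesAt_of_pullGerm_dvd {J : ∀ U : X.S.left.affineOpens, Ideal (X.alg U)}
    {p : X'.C ⟶ X.C} {U : X.S.left.affineOpens} {U' : X'.S.left.affineOpens}
    (hU : X'.π.left ⁻¹ᵁ U'.1 ≤ p.left ⁻¹ᵁ (X.π.left ⁻¹ᵁ U.1)) {z : KPoint X'.C}
    (hz : z.pos ∈ X'.π.left ⁻¹ᵁ U'.1) {f : X.alg U}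
    (hdvd : ∀ a ∈ J U, pullGerm p.left z.pos (hU hz) f ∣ pullGerm p.left z.pos (hU hz) a) :
    GeneratesAt (p.left.appLE _ _ hU).hom
      (evalAt z (X'.π.left ⁻¹ᵁ U'.1) (top_le_of_pos_mem hz)) (J U) f := by
  have := X'.isVariety_C.isIntegral
  intro a ha
  obtain ⟨c, hc⟩ := hdvd a ha
  have hV := X'.isAffineOpen_preimage U'
  let := X'.C.left.presheaf.algebra_section_stalk ⟨z.pos, hz⟩
  have := hV.isLocalization_stalk ⟨z.pos, hz⟩
  obtain ⟨⟨c', s⟩, hs⟩ := IsLocalization.surj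
    (hV.primeIdealOf ⟨z.pos, hz⟩).asIdeal.primeCompl c
  have hs' : c * (X'.C.left.presheaf.germ _ z.pos hz).hom s.1 =
    (X'.C.left.presheaf.germ _ z.pos hz).hom c' := hs
  have hunit : IsUnit ((X'.C.left.presheaf.germ _ z.pos hz).hom s.1) :=
    IsLocalization.map_units (X'.C.left.presheaf.stalk z.pos) s
  refine ⟨s.1, c', (mem_basicOpen_iff_evalAt_ne_zero z (top_le_of_pos_mem hz) s.1).1
    ((Scheme.mem_basicOpen _ _ z.pos hz).2 hunit), ?_⟩
  apply germ_injective_of_isIntegral X'.C.left z.pos hz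
  change (X'.C.left.presheaf.germ _ z.pos hz).hom _ = (X'.C.left.presheaf.germ _ z.pos hz).hom _
  rw [map_mul, map_mul, germ_appLE, germ_appLE, hc, ← hs']
  ring

/-- The points of the zero section of the modification have stabilisers of dimension `d(π)`. -/
theorem IsModification.dimStab_eq [IsAlgClosed k] (hw : 0 < w)
    (hX' : X.IsModification X.centreIdeal X') {z : KPoint X'.C} (hz : z ∈ X'.zeroSection) :
    X'.dimStab z = X.d := by
  obtain ⟨B, b, gmB, j, q, hb, hgmB, hj, -, hgmj, hga, hq⟩ := hX'
  have hgm : ∀ {T : SchOver k} (t : (Γ(T.left, ⊤))ˣ) (x : T ⟶ X'.C),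
      X'.gm.act t x ≫ j ≫ b = X.gm.act t (x ≫ j ≫ b) := by
    intro T t x
    rw [← Category.assoc, hgmj, hgmB, Category.assoc]
  have := X'.isVariety_C.isIntegral
  have := X'.isVariety_S.isIntegral
  have hd := X.d_le
  obtain ⟨U, hzU, f, hf, -, hdvd⟩ := hb.exists_pullGerm j.left z.pos
  have hq' : X'.π.left ≫ q.left = (j ≫ b).left ≫ X.π.left := congr($(hq).left)
  obtain ⟨U', hzU', hU'⟩ : ∃ U' : X'.S.left.affineOpens,
      z.pos ∈ X'.π.left ⁻¹ᵁ U'.1 ∧ U'.1 ≤ q.left ⁻¹ᵁ U.1 := by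
    have hqz : X'.π.left z.pos ∈ q.left ⁻¹ᵁ U.1 := by
      change q.left (X'.π.left z.pos) ∈ U.1
      rw [← Scheme.Hom.comp_apply, hq']
      exact hzU
    obtain ⟨V, hV, hzV, hle⟩ := exists_isAffineOpen_mem_and_subset hqz
    exact ⟨⟨V, hV⟩, hzV, hle⟩
  have hU : X'.π.left ⁻¹ᵁ U'.1 ≤ (j ≫ b).left ⁻¹ᵁ (X.π.left ⁻¹ᵁ U.1) := by
    rw [← Scheme.Hom.comp_preimage, ← hq', Scheme.Hom.comp_preimage]
    exact fun x hx ↦ hU' hx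
  have hz' : ⊤ ≤ z.left ⁻¹ᵁ (X'.π.left ⁻¹ᵁ U'.1) := top_le_of_pos_mem hzU'
  have : Nonempty (X'.π.left ⁻¹ᵁ U'.1) := ⟨⟨_, hzU'⟩⟩
  obtain ⟨δ, hδ, hδ0⟩ := X.exists_derivMinors_ne_zero U ⟨_, hzU⟩
  have hδφ : ((j ≫ b).left.appLE _ _ hU).hom δ ≠ 0 := appLE_ne_zero hb hj hU ⟨_, hzU'⟩ hδ0
  have hδJ := X.derivMinors_subset_centreIdeal U hδ
  have hδgr := X.mem_gr_zero_of_mem_derivMinors hδ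
  apply le_antisymm
  -- A minor of size `r - d(π)` that does not vanish at `z` gives the upper bound.
  · obtain ⟨c, s, hdet⟩ := exists_minor_ne_zero_of_generatesAt (𝒜 := X.gr U) (𝒜' := X'.gr U')
      (fun n a ha ↦ appLE_mem_gr hgm hU ha) (X'.evalAt_proj_zero hz U' hz')
      (fun a ha ↦ X.proj_zero_mem_centreIdeal ha) hδgr hδJ hδφ
      (fun i a ha ↦ X.vectorField_of_mem_zero i ha)
      (fun i a ha ↦ X.vectorField_mem i (by rwa [zero_add]))
      (fun i a ha ↦ X'.vectorField_of_mem_zero i ha)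
      (appLE_vectorField hga hU)
      (fun a ha ↦ X.proj_zero_mem_span_derivMinors ha)
      (X.derivMinors_subset_centreIdeal U)
      (fun g hg h ↦ X.mem_centreIdeal_of_vectorField_mem hw hg h)
      ⟨f, hf, generatesAt_of_pullGerm_dvd (J := X.centreIdeal) hU hzU' hdvd⟩
    have := X'.dimStab_add_le hz' c s hdet
    omega
  · by_contra! hlt
    -- If the dimension at `z` were below `d(π)`, then a minor of size `r - d(π) + 1` would keep it
    -- below `d(π)` over a neighbourhood in `S'`.
    obtain ⟨a, ha, hle⟩ := X'.exists_dimStab_add_le hz hz' (n := r - X.d + 1) (by omega)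
    obtain ⟨a₀, ha₀⟩ := X'.mem_gr_zero.1 (appLE_mem_gr hgm hU hδgr)
    have hne : (X'.S.left.basicOpen a₀ : Set X'.S.left).Nonempty := by
      by_contra hemp
      rw [Set.not_nonempty_iff_eq_empty] at hemp
      rw [← ha₀, (basicOpen_eq_bot_iff a₀).1 (Opens.ext hemp), map_zero] at hδφ
      exact hδφ rfl
    -- By irreducibility of `S'` that neighbourhood contains the image of a `z₁ ∈ Z'` at which `δ ∈
    -- 𝒥` does not vanish, where stabilisers can be compared with those on `Z`.
    obtain ⟨z₁, hz₁, hz₁a, hz₁a₀⟩ := X'.exists_zeroSection_mem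
      (W := X'.S.left.basicOpen a ⊓ X'.S.left.basicOpen a₀)
      (nonempty_preirreducible_inter (X'.S.left.basicOpen a).2 (X'.S.left.basicOpen a₀).2
        ⟨_, ha⟩ hne)
    have h₁ : ⊤ ≤ z₁.left ⁻¹ᵁ (X'.π.left ⁻¹ᵁ U'.1) :=
      top_le_of_pos_mem (X'.S.left.basicOpen_le a hz₁a)
    have hp : ⊤ ≤ (z₁ ≫ j ≫ b).left ⁻¹ᵁ (X.π.left ⁻¹ᵁ U.1) := fun x hx ↦ hU (h₁ hx)
    have hpos : KPoint.pos (X := X.C) (z₁ ≫ j ≫ b) ∈ X.C.left.basicOpen δ := by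
      rw [mem_basicOpen_iff_evalAt_ne_zero (X := X.C) (z₁ ≫ j ≫ b) hp,
        evalAt_comp z₁ (j ≫ b) h₁ hU hp, ← ha₀]
      exact (X'.mem_basicOpen_iff h₁ a₀).1 hz₁a₀
    have h2 := dimStab_comp_le hb hj hga hδJ hpos
    have h3 := X.d_le_dimStab (comp_mem_zeroSection hgm hz₁)
    have h4 := hle z₁ hz₁a
    omega

end Cone

end AdditiveCone

end

theorem proposition4p1 {k : Type u} [Field k] [IsAlgClosed k] [CharZero k] (r w : ℕ)
    (hr : 0 < r) (hw : 0 < w) (X X' : AdditiveCone.Cone k r w)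
    (hX' : X.IsModification X.centreIdeal X') :
    (∀ z' ∈ X'.zeroSection, X'.dimStab z' = X.d) ∧ X'.d = X.d := by
  refine ⟨fun z' hz' ↦ hX'.dimStab_eq hw hz', ?_⟩
  obtain ⟨z', hz', hd⟩ := X'.exists_dimStab_eq_d
  rw [← hd, hX'.dimStab_eq hw hz']
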